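/- **Conventions.** Let $k=\mathbb R$ or $\mathbb C$. A dendriform algebra over $k$ is a $k$-vector space with two bilinear operations $\prec,\succ$ such that $(x\prec y)\prec z=x\prec(y\prec z+y\succ z)$, $(x\succ y)\prec z=x\succ(y\prec z)$ and $x\succ(y\succ z)=(x\prec y+x\succ y)\succ z$. A dendriform morphism is a linear map that preserves $\prec$ and $\succ$. *Functions.* Let $B$ be a unital, not necessarily commutative, Banach algebra over $k$ (for example $B=\mathcal M_N(\mathbb C)$), and let $\mathcal A$ be the space of classes, modulo equality almost everywhere, of functions $f:(0,\infty)\to B$ that are integrable on $(0,s)$ for every $s>0$. Put $Rf(s)=\int_0^s f(u)\,du$, $f\prec g=f\cdot R(g)$ and $f\succ g=R(f)\cdot g$. *Permutations.* Let $\mathcal H'=\bigoplus_{n\ge1}k[S_n]$. For $\sigma\in S_n$ and $\tau\in S_m$ let $\sigma\times\tau\in S_{n+m}$ be their concatenation and put $$\sigma\prec\tau=\sum_{\omega(n)=n+m}\omega\circ(\sigma\times\tau),\qquad \sigma\succ\tau=\sum_{\omega(n+m)=n+m}\omega\circ(\sigma\times\tau),$$ where $\omega$ runs over the $(n,m)$-shuffles,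 i.e. the $\omega\in S_{n+m}$ with $\omega(1)<\dots<\omega(n)$ and $\omega(n+1)<\dots<\omega(n+m)$, that satisfy the condition shown. *Trees.* Let $\mathcal T'$ be the span of the planar binary trees different from the tree $|$ without internal vertex, let $\vee$ be grafting and $Y=|\vee|$. For $s=s_1\vee s_2$ and $t=t_1\vee t_2$ put $s\prec t=s_1\vee(s_2*t)$, $s\succ t=(s*t_1)\vee t_2$ and $s*t=s\prec t+s\succ t$, where $|$ is the unit of $*$. Let $\psi(\sigma)$ be the planar binary tree attached to the word $\sigma_1\cdots\sigma_n$ of $\sigma\in S_n$ as follows: the empty word has tree $|$, and a non-empty word has tree $t_1\vee t_2$, where $t_1$ and $t_2$ are the trees of the parts of the word before and after its largest letter. Let $\psi^*:\mathcal T'\to\mathcal H'$ be the linear map with $\psi^*(t)=\sum_{\psi(\sigma)=t}\sigma$, the sum being over $\sigma\in S_{|t|}$, where $|t|$ is the number of internal vertices of $t$. **Theorem 5.3.** With these operations $\mathcal H'$, $\mathcal T'$ and $\mathcal A$ are dendriform algebras. Let $a\in\mathcal A$. For all $n\ge1$ and $\sigma\in S_n$ the function $u\mapsto a(u_{\sigma_1})\cdots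 a(u_{\sigma_n})$ is integrable on each simplex $0<u_1<\dots<u_n<s$; the derivative $$\widetilde F_a(\sigma)(s):=\frac{d}{ds}\int\!\cdots\!\int_{0<u_1<\cdots<u_n<s}a(u_{\sigma_1})\cdots a(u_{\sigma_n})\,du_1\cdots du_n$$ exists for almost every $s>0$ and defines an element of $\mathcal A$, so that $\widetilde F_a$ extends uniquely to a linear map $\widetilde F_a:\mathcal H'\to\mathcal A$. This map is a dendriform morphism. There is a unique dendriform morphism $F_a:\mathcal T'\to\mathcal A$ with $F_a(Y)=a$, and $$F_a=\widetilde F_a\circ\psi^*.$$ -/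

import Mathlib

open MeasureTheory

namespace MagnusPerm

/-! ### Dendriform algebras -/

/-- A pair of bilinear operations `≺` and `≻` on a `k`-module. -/
structure DendOps (k D : Type*) [CommSemiring k] [AddCommMonoid D] [Module k D] where
  prec : D →ₗ[k] D →ₗ[k] D
  succ : D →ₗ[k] D →ₗ[k] D

/-- The three axioms of a dendriform algebra. -/
structure DendOps.IsDendriform {k D : Type*} [CommSemiring k] [AddCommMonoid D] [Module k D]
    (P : DendOps k D) : Prop where
  prec_prec : ∀ a b c, P.prec (P.prec a b) c = P.prec a (P.prec b c + P.succ b c)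
  succ_prec : ∀ a b c, P.prec (P.succ a b) c = P.succ a (P.prec b c)
  succ_succ : ∀ a b c, P.succ a (P.succ b c) = P.succ (P.prec a b + P.succ a b) c

/-- A dendriform morphism: a linear map that preserves `≺` and `≻`. -/
structure IsDendHom {k D E : Type*} [CommSemiring k] [AddCommMonoid D] [Module k D]
    [AddCommMonoid E] [Module k E] (P : DendOps k D) (Q : DendOps k E) (f : D →ₗ[k] E) :
    Prop where
  map_prec : ∀ x y, f (P.prec x y) = Q.prec (f x) (f y)
  map_succ : ∀ x y, f (P.succ x y) = Q.succ (f x) (f y)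

/-- The bilinear map with prescribed values on pairs of basis vectors. -/
noncomputable def bilin (k : Type*) {X D : Type*} [CommSemiring k] [AddCommMonoid D] [Module k D]
    (f : X → X → D) : (X →₀ k) →ₗ[k] (X →₀ k) →ₗ[k] D :=
  Finsupp.linearCombination k fun x =>
    (Finsupp.linearCombination k fun y => f x y : (X →₀ k) →ₗ[k] D)

/-! ### The dendriform algebra of permutations -/

/-- The disjoint union of the symmetric groups `S_n`, `n ≥ 1`. -/
abbrev PermIdx : Type := {p : Σ n : ℕ, Equiv.Perm (Fin n) // 0 < p.1}

/-- A permutation of `n ≥ 1` letters as an element of the disjoint union. -/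
abbrev permIdx {n : ℕ} (hn : 0 < n) (σ : Equiv.Perm (Fin n)) : PermIdx := ⟨⟨n, σ⟩, hn⟩

/-- The direct sum over `n ≥ 1` of the spaces `k[S_n]`: the vector space with basis the disjoint
union of the `S_n`, `n ≥ 1`. -/
abbrev PermSpace (k : Type*) [CommSemiring k] : Type _ := PermIdx →₀ k

/-- The concatenation `σ × τ`: `σ` acts on the first `n` letters and `τ` on the last `m`. -/
def concat {n m : ℕ} (σ : Equiv.Perm (Fin n)) (τ : Equiv.Perm (Fin m)) :
    Equiv.Perm (Fin (n + m)) :=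
  finSumFinEquiv.permCongr (Equiv.sumCongr σ τ)

/-- `(n, m)`-shuffles: `ω(1) < ⋯ < ω(n)` and `ω(n+1) < ⋯ < ω(n+m)`. -/
def IsShuffle (n m : ℕ) (ω : Equiv.Perm (Fin (n + m))) : Prop :=
  StrictMono (fun i : Fin n => ω (Fin.castAdd m i)) ∧
    StrictMono (fun j : Fin m => ω (Fin.natAdd n j))

/-- `Sh¹`: the shuffles `ω` with `ω(n+m) = n+m` (letters are numbered from `0` here). -/
def IsShuffle₁ (n m : ℕ) (ω : Equiv.Perm (Fin (n + m))) : Prop :=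
  IsShuffle n m ω ∧ ∀ i : Fin (n + m), (i : ℕ) + 1 = n + m → (ω i : ℕ) + 1 = n + m

/-- `Sh²`: the shuffles `ω` with `ω(n) = n+m` (letters are numbered from `0` here). -/
def IsShuffle₂ (n m : ℕ) (ω : Equiv.Perm (Fin (n + m))) : Prop :=
  IsShuffle n m ω ∧ ∀ i : Fin (n + m), (i : ℕ) + 1 = n → (ω i : ℕ) + 1 = n + m

open Classical in
/-- `σ ≺ τ = ∑ ω ∘ (σ × τ)` over `ω ∈ Sh²`, and `σ ≻ τ = ∑ ω ∘ (σ × τ)` over `ω ∈ Sh¹`. -/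
noncomputable def permDend (k : Type*) [CommSemiring k] : DendOps k (PermSpace k) where
  prec := bilin k fun x y =>
    ∑ ω : Equiv.Perm (Fin (x.1.1 + y.1.1)) with IsShuffle₂ x.1.1 y.1.1 ω,
      Finsupp.single (permIdx (Nat.add_pos_left x.2 _) (ω * concat x.1.2 y.1.2)) 1
  succ := bilin k fun x y =>
    ∑ ω : Equiv.Perm (Fin (x.1.1 + y.1.1)) with IsShuffle₁ x.1.1 y.1.1 ω,
      Finsupp.single (permIdx (Nat.add_pos_left x.2 _) (ω * concat x.1.2 y.1.2)) 1

/-! ### The dendriform algebra of planar binary trees -/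

/-- Planar binary trees: `nil` is the tree `|` without internal vertex, and
`graft t₁ t₂ = t₁ ∨ t₂`. -/
abbrev PBT : Type := BinaryTree Unit

/-- The grafting `t₁ ∨ t₂`. -/
abbrev graft (s t : PBT) : PBT := BinaryTree.node () s t

/-- The planar binary trees different from `|`. -/
abbrev TreeIdx : Type := {t : PBT // t ≠ BinaryTree.nil}

/-- `t₁ ∨ t₂` as a tree different from `|`. -/
def graft' (s t : PBT) : TreeIdx := ⟨graft s t, by simp [graft]⟩

/-- The tree `Y = | ∨ |`. -/
def treeY : TreeIdx := graft' BinaryTree.nil BinaryTree.nil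

/-- The linear span of the planar binary trees different from `|`. -/
abbrev TreeSpace (k : Type*) [CommSemiring k] : Type _ := TreeIdx →₀ k

/-- The product of trees: `|` is a unit, and for `s = s₁ ∨ s₂` and `t = t₁ ∨ t₂`,
`s * t = s₁ ∨ (s₂ * t) + (s * t₁) ∨ t₂`. -/
noncomputable def treeMul (k : Type*) [CommSemiring k] : PBT → PBT → (PBT →₀ k)
  | .nil, t => Finsupp.single t 1
  | .node u s₁ s₂, .nil => Finsupp.single (.node u s₁ s₂) 1
  | .node u s₁ s₂, .node v t₁ t₂ =>
      (treeMul k s₂ (.node v t₁ t₂)).mapDomain (fun r => graft s₁ r) +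
        (treeMul k (.node u s₁ s₂) t₁).mapDomain (fun r => graft r t₂)
termination_by s t => s.numNodes + t.numNodes
decreasing_by
  · simp only [BinaryTree.numNodes]; omega
  · simp only [BinaryTree.numNodes]; omega

/-- `s ≺ t = s₁ ∨ (s₂ * t)` and `s ≻ t = (s * t₁) ∨ t₂` for `s = s₁ ∨ s₂`, `t = t₁ ∨ t₂`. -/
noncomputable def treeDend (k : Type*) [CommSemiring k] : DendOps k (TreeSpace k) where
  prec := bilin k fun s t =>
    (treeMul k s.1.right t.1).mapDomain fun r => graft' s.1.left r
  succ := bilin k fun s t =>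
    (treeMul k s.1 t.1.left).mapDomain fun r => graft' r t.1.right

/-! ### From permutations to trees -/

theorem foldr_max_mem : ∀ (x : ℕ) (l : List ℕ), (x :: l).foldr max 0 ∈ x :: l
  | x, [] => by simp
  | x, y :: l => by
      have h := foldr_max_mem y l
      rw [List.foldr_cons]
      rcases max_choice x ((y :: l).foldr max 0) with h' | h'
      · rw [h']; exact List.mem_cons_self
      · rw [h']; exact List.mem_cons_of_mem _ h

/-- The tree of a word with distinct letters: the part before the largest letter gives the left
subtree and the part after it gives the right subtree. Only the relative order of the letters
matters, so the two parts need not be standardized. -/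
def treeOfWord : List ℕ → PBT
  | [] => .nil
  | x :: l =>
      graft (treeOfWord ((x :: l).take ((x :: l).idxOf ((x :: l).foldr max 0))))
        (treeOfWord ((x :: l).drop ((x :: l).idxOf ((x :: l).foldr max 0) + 1)))
termination_by l => l.length
decreasing_by
  · rw [List.length_take]
    exact lt_of_le_of_lt (min_le_left _ _) (List.idxOf_lt_length_iff.2 (foldr_max_mem x l))
  · rw [List.length_drop, List.length_cons]
    omega

/-- The map `ψ` from permutations to planar binary trees: the tree of the word `σ(1) ⋯ σ(n)`. -/
def psi {n : ℕ} (σ : Equiv.Perm (Fin n)) : PBT :=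
  treeOfWord (List.ofFn fun i => (σ i : ℕ))

theorem numNodes_pos (t : TreeIdx) : 0 < t.1.numNodes := by
  obtain ⟨t, ht⟩ := t
  cases t with
  | nil => exact absurd rfl ht
  | node _ _ _ => simp [BinaryTree.numNodes]

open Classical in
/-- The linear map `ψ*`, which sends `t` to the sum of all `σ ∈ S_{|t|}` with `ψ(σ) = t`, where
`|t|` is the number of internal vertices of `t`. -/
noncomputable def psiStar (k : Type*) [CommSemiring k] : TreeSpace k →ₗ[k] PermSpace k :=
  Finsupp.linearCombination k fun t =>
    ∑ σ : Equiv.Perm (Fin t.1.numNodes) with psi σ = t.1,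
      Finsupp.single (permIdx (numNodes_pos t) σ) 1

/-! ### The dendriform algebra of locally integrable functions -/

/-- Lebesgue measure on the half-line `(0, ∞)`, seen as a measure on `ℝ`. -/
noncomputable abbrev halfLine : Measure ℝ := volume.restrict (Set.Ioi 0)

theorem locallyIntegrable_congr {B : Type*} [NormedAddCommGroup B] {f g : ℝ → B} {μ : Measure ℝ}
    (hf : LocallyIntegrable f μ) (h : f =ᵐ[μ] g) : LocallyIntegrable g μ := fun x => by
  obtain ⟨s, hs, hi⟩ := hf x
  exact ⟨s, hs, hi.congr_fun_ae (ae_restrict_of_ae h)⟩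

/-- The `k`-vector space of (classes modulo null sets of) functions on the half-line with values in
`B` that are integrable on `(0, s)` for all `s`: local integrability with respect to `halfLine`
is asked at all points of `ℝ`, and so in particular at `0`. -/
def LocInt (k B : Type*) [RCLike k] [NormedRing B] [NormedAlgebra k B] :
    Submodule k (ℝ →ₘ[halfLine] B) where
  carrier := {f | LocallyIntegrable f halfLine}
  zero_mem' := locallyIntegrable_congr locallyIntegrable_zero AEEqFun.coeFn_zero.symm
  add_mem' := fun {f g} hf hg => locallyIntegrable_congr (hf.add hg) (AEEqFun.coeFn_add f g).symm
  smul_mem' := fun c f hf => locallyIntegrable_congr (hf.smul c) (AEEqFun.coeFn_smul c f).symm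

section Functions

set_option linter.unusedSectionVars false

variable {k B : Type*} [RCLike k] [NormedRing B] [NormedAlgebra ℝ B] [NormedAlgebra k B]

/-- `R f (s) = ∫_0^s f(u) du`. -/
noncomputable def prim (f : LocInt k B) (s : ℝ) : B :=
  ∫ u in (0 : ℝ)..s, f.1 u ∂halfLine

theorem intervalIntegrable_locInt (f : LocInt k B) (x y : ℝ) :
    IntervalIntegrable f.1 halfLine x y :=
  (LocallyIntegrable.integrableOn_isCompact f.2 isCompact_uIcc).intervalIntegrable

theorem continuous_prim (f : LocInt k B) : Continuous (prim f) :=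
  intervalIntegral.continuous_primitive (intervalIntegrable_locInt f) 0

theorem prim_congr {f : LocInt k B} {g : ℝ → B} (h : f.1 =ᵐ[halfLine] g) (s : ℝ) :
    prim f s = ∫ u in (0 : ℝ)..s, g u ∂halfLine :=
  intervalIntegral.integral_congr_ae_restrict (ae_restrict_of_ae h)

theorem prim_add (f g : LocInt k B) (s : ℝ) : prim (f + g) s = prim f s + prim g s := by
  rw [prim_congr (g := fun u => f.1 u + g.1 u) (AEEqFun.coeFn_add f.1 g.1)]
  exact intervalIntegral.integral_add (intervalIntegrable_locInt f 0 s)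
    (intervalIntegrable_locInt g 0 s)

theorem prim_smul (c : k) (f : LocInt k B) (s : ℝ) : prim (c • f) s = c • prim f s := by
  have : IsScalarTower ℝ k B := Real.isScalarTower
  have : SMulCommClass ℝ k B := IsScalarTower.to_smulCommClass
  rw [prim_congr (g := fun u => c • f.1 u) (AEEqFun.coeFn_smul c f.1)]
  exact intervalIntegral.integral_smul c _

/-- The class of `s ↦ f(s) g(s)` for `f` locally integrable and `g` continuous. -/
noncomputable def mulRight (f : LocInt k B) (g : ℝ → B) (hg : Continuous g) : LocInt k B :=
  ⟨AEEqFun.mk (fun s => f.1 s * g s) (f.1.aestronglyMeasurable.mul hg.aestronglyMeasurable),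
    locallyIntegrable_congr
      (locallyIntegrableOn_univ.1 ((locallyIntegrableOn_univ.2 f.2).mul_continuousOn
        hg.continuousOn isOpen_univ.isLocallyClosed)) (AEEqFun.coeFn_mk _ _).symm⟩

/-- The class of `s ↦ g(s) f(s)` for `f` locally integrable and `g` continuous. -/
noncomputable def mulLeft (g : ℝ → B) (hg : Continuous g) (f : LocInt k B) : LocInt k B :=
  ⟨AEEqFun.mk (fun s => g s * f.1 s) (hg.aestronglyMeasurable.mul f.1.aestronglyMeasurable),
    locallyIntegrable_congr
      (locallyIntegrableOn_univ.1 ((locallyIntegrableOn_univ.2 f.2).continuousOn_mul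
        hg.continuousOn isOpen_univ.isLocallyClosed)) (AEEqFun.coeFn_mk _ _).symm⟩

theorem mulRight_coe (f : LocInt k B) (g : ℝ → B) (hg : Continuous g) :
    (mulRight f g hg).1 =ᵐ[halfLine] fun s => f.1 s * g s := AEEqFun.coeFn_mk _ _

theorem mulLeft_coe (g : ℝ → B) (hg : Continuous g) (f : LocInt k B) :
    (mulLeft g hg f).1 =ᵐ[halfLine] fun s => g s * f.1 s := AEEqFun.coeFn_mk _ _

theorem locInt_ext {f g : LocInt k B} (h : f.1 =ᵐ[halfLine] g.1) : f = g :=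
  Subtype.ext (AEEqFun.ext h)

/-- The dendriform operations `(f ≺ g)(s) = f(s) ∫_0^s g(u) du` and
`(f ≻ g)(s) = (∫_0^s f(u) du) g(s)` on locally integrable functions. -/
noncomputable def funDend (k B : Type*) [RCLike k] [NormedRing B] [NormedAlgebra ℝ B]
    [NormedAlgebra k B] : DendOps k (LocInt k B) where
  prec := LinearMap.mk₂ k (fun f g => mulRight f (prim g) (continuous_prim g))
    (fun f f' g => locInt_ext <| by
      filter_upwards [mulRight_coe (f + f') (prim g) (continuous_prim g),
        mulRight_coe f (prim g) (continuous_prim g), mulRight_coe f' (prim g) (continuous_prim g),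
        AEEqFun.coeFn_add f.1 f'.1, AEEqFun.coeFn_add (mulRight f (prim g) (continuous_prim g)).1
          (mulRight f' (prim g) (continuous_prim g)).1] with s h₁ h₂ h₃ h₄ h₅
      rw [h₁, Submodule.coe_add, Submodule.coe_add, h₄, h₅, Pi.add_apply, Pi.add_apply, h₂, h₃,
        add_mul])
    (fun c f g => locInt_ext <| by
      filter_upwards [mulRight_coe (c • f) (prim g) (continuous_prim g),
        mulRight_coe f (prim g) (continuous_prim g), AEEqFun.coeFn_smul c f.1,
        AEEqFun.coeFn_smul c (mulRight f (prim g) (continuous_prim g)).1] with s h₁ h₂ h₃ h₄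
      rw [h₁, Submodule.coe_smul, Submodule.coe_smul, h₃, h₄, Pi.smul_apply, Pi.smul_apply, h₂,
        smul_mul_assoc])
    (fun f g g' => locInt_ext <| by
      filter_upwards [mulRight_coe f (prim (g + g')) (continuous_prim (g + g')),
        mulRight_coe f (prim g) (continuous_prim g), mulRight_coe f (prim g') (continuous_prim g'),
        AEEqFun.coeFn_add (mulRight f (prim g) (continuous_prim g)).1
          (mulRight f (prim g') (continuous_prim g')).1] with s h₁ h₂ h₃ h₄
      rw [h₁, Submodule.coe_add, h₄, Pi.add_apply, h₂, h₃, prim_add, mul_add])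
    (fun c f g => locInt_ext <| by
      filter_upwards [mulRight_coe f (prim (c • g)) (continuous_prim (c • g)),
        mulRight_coe f (prim g) (continuous_prim g),
        AEEqFun.coeFn_smul c (mulRight f (prim g) (continuous_prim g)).1] with s h₁ h₂ h₃
      rw [h₁, Submodule.coe_smul, h₃, Pi.smul_apply, h₂, prim_smul, mul_smul_comm])
  succ := LinearMap.mk₂ k (fun f g => mulLeft (prim f) (continuous_prim f) g)
    (fun f f' g => locInt_ext <| by
      filter_upwards [mulLeft_coe (prim (f + f')) (continuous_prim (f + f')) g,
        mulLeft_coe (prim f) (continuous_prim f) g, mulLeft_coe (prim f') (continuous_prim f') g,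
        AEEqFun.coeFn_add (mulLeft (prim f) (continuous_prim f) g).1
          (mulLeft (prim f') (continuous_prim f') g).1] with s h₁ h₂ h₃ h₄
      rw [h₁, Submodule.coe_add, h₄, Pi.add_apply, h₂, h₃, prim_add, add_mul])
    (fun c f g => locInt_ext <| by
      filter_upwards [mulLeft_coe (prim (c • f)) (continuous_prim (c • f)) g,
        mulLeft_coe (prim f) (continuous_prim f) g,
        AEEqFun.coeFn_smul c (mulLeft (prim f) (continuous_prim f) g).1] with s h₁ h₂ h₃
      rw [h₁, Submodule.coe_smul, h₃, Pi.smul_apply, h₂, prim_smul, smul_mul_assoc])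
    (fun f g g' => locInt_ext <| by
      filter_upwards [mulLeft_coe (prim f) (continuous_prim f) (g + g'),
        mulLeft_coe (prim f) (continuous_prim f) g, mulLeft_coe (prim f) (continuous_prim f) g',
        AEEqFun.coeFn_add g.1 g'.1, AEEqFun.coeFn_add (mulLeft (prim f) (continuous_prim f) g).1
          (mulLeft (prim f) (continuous_prim f) g').1] with s h₁ h₂ h₃ h₄ h₅
      rw [h₁, Submodule.coe_add, Submodule.coe_add, h₄, h₅, Pi.add_apply, Pi.add_apply, h₂, h₃,
        mul_add])
    (fun c f g => locInt_ext <| by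
      filter_upwards [mulLeft_coe (prim f) (continuous_prim f) (c • g),
        mulLeft_coe (prim f) (continuous_prim f) g, AEEqFun.coeFn_smul c g.1,
        AEEqFun.coeFn_smul c (mulLeft (prim f) (continuous_prim f) g).1] with s h₁ h₂ h₃ h₄
      rw [h₁, Submodule.coe_smul, Submodule.coe_smul, h₃, h₄, Pi.smul_apply, Pi.smul_apply, h₂,
        mul_smul_comm])

/-! ### Iterated integrals -/

/-- The open simplex `0 < u_1 < ⋯ < u_n < s`. -/
def simplex (n : ℕ) (s : ℝ) : Set (Fin n → ℝ) :=
  {u | StrictMono u ∧ ∀ i, 0 < u i ∧ u i < s}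

/-- The product `a(u_{σ(1)}) ⋯ a(u_{σ(n)})`, in this order. -/
noncomputable def permProd (a : LocInt k B) {n : ℕ} (σ : Equiv.Perm (Fin n)) (u : Fin n → ℝ) : B :=
  (List.ofFn fun i => a.1 (u (σ i))).prod

/-- The integral of `a(u_{σ(1)}) ⋯ a(u_{σ(n)})` over the simplex `0 < u_1 < ⋯ < u_n < s`. -/
noncomputable def iterInt (a : LocInt k B) {n : ℕ} (σ : Equiv.Perm (Fin n)) (s : ℝ) : B :=
  ∫ u in simplex n s, permProd a σ u

/-- The linear map `Ft` on the span of all permutations sends each `σ` to the derivative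
`d/ds ∫ a(u_{σ(1)}) ⋯ a(u_{σ(n)}) du` over the simplex `0 < u_1 < ⋯ < u_n < s`: the derivative
exists for almost all `s > 0`, and `Ft σ` is the class of this derivative. -/
def IsFTilde (a : LocInt k B) (Ft : PermSpace k →ₗ[k] LocInt k B) : Prop :=
  ∀ (n : ℕ) (hn : 0 < n) (σ : Equiv.Perm (Fin n)), ∀ᵐ s ∂halfLine,
    HasDerivAt (iterInt a σ) ((Ft (Finsupp.single (permIdx hn σ) 1)).1 s) s

/-- The linear map `F` is a dendriform morphism from the trees to the locally integrable functions,
and it sends the tree `Y` to `a`. -/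
def IsFa (a : LocInt k B) (F : TreeSpace k →ₗ[k] LocInt k B) : Prop :=
  IsDendHom (treeDend k) (funDend k B) F ∧ F (Finsupp.single treeY 1) = a

end Functions

end MagnusPerm

namespace MagnusPerm

/-! ### Standardization -/

/-! Permutations and trees are both embedded in one dendriform algebra, the functions on words over
ℕ. There the product is convolution over the cuts `w = xy`, split according to which factor contains
the leftmost largest letter. Its axioms amount to comparing the maxima of three consecutive factors
(`wordConv_assoc`, `wordDend_isDendriform`). A permutation goes to the indicator of the words that
it standardizes, and a tree to the indicator of the words with that tree. Both maps are injective
and compatible with the operations (`permToWord_isDendHom`, `treeToWord_isDendHom`), so the axioms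
descend to both spaces. The tree of a word depends only on its standardization. The embedding of
trees is therefore `ψ*` followed by that of permutations (`permToWord_psiStar`), which makes `ψ*` a
morphism.

For functions, the axioms follow from associativity in `B` and from `R(f) R(g) = R(f ≺ g + f ≻ g)`,
which is Fubini on a square cut along its diagonal (`prim_mul_prim`). Integrating out all variables
but the largest gives a locally integrable function whose primitive is the iterated integral. By
Lebesgue differentiation it is the required derivative, and equality in `LocInt` can be tested on
primitives.

The primitive of a half-product of two such derivatives is an integral over pairs of simplices, one
variable of which dominates all the others. Up to the null set where two coordinates agree, this
domain is the disjoint union of the simplices selected by the shuffles of the half-product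
(`integral_eq_sum_iterInt`), so the derivative map is a morphism. Finally `Y` generates the trees,
since `s ∨ t = (s ≻ Y) ≺ t`. Hence `F_a` is unique, and the composite with `ψ*` provides its
existence. -/

theorem exists_perm_lt_iff {α : Type*} [LinearOrder α] {n : ℕ} (x : Fin n → α)
    (hx : Function.Injective x) : ∃ ρ : Equiv.Perm (Fin n), ∀ i j, ρ i < ρ j ↔ x i < x j := by
  have h : StrictMono (x ∘ Tuple.sort x) :=
    (Tuple.monotone_sort x).strictMono_of_injective (hx.comp (Tuple.sort x).injective)
  refine ⟨(Tuple.sort x)⁻¹, fun i j => ?_⟩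
  rw [← h.lt_iff_lt]
  simp

/-- The quotient `ρ' * ρ⁻¹` is increasing, and the identity is the only increasing permutation. -/
theorem perm_eq_of_lt_iff {n : ℕ} {ρ ρ' : Equiv.Perm (Fin n)}
    (h : ∀ i j, ρ i < ρ j ↔ ρ' i < ρ' j) : ρ = ρ' := by
  have hm : StrictMono (ρ' * ρ⁻¹) := fun i j hij => by
    have := (h (ρ⁻¹ i) (ρ⁻¹ j)).1 (by simpa using hij)
    simpa using this
  have := (Equiv.Perm.monotone_iff _).1 hm.monotone
  exact (mul_inv_eq_one.1 this).symm

/-- `ρ` is the standardization of `x`, equal letters being numbered from right to left. -/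
def IsStd {α : Type*} [LT α] {n : ℕ} (ρ : Equiv.Perm (Fin n)) (x : Fin n → α) : Prop :=
  ∀ i j, i < j → (ρ i < ρ j ↔ x i < x j)

theorem exists_isStd {α : Type*} [LinearOrder α] {n : ℕ} (x : Fin n → α) :
    ∃ ρ : Equiv.Perm (Fin n), IsStd ρ x := by
  -- Breaking ties by the reversed position makes the letters distinct. Among equal letters the
  -- leftmost gets the highest rank, in agreement with `treeOfWord`, which cuts at the leftmost
  -- maximum.
  obtain ⟨ρ, hρ⟩ := exists_perm_lt_iff (fun i => toLex (x i, OrderDual.toDual i)) (fun i j h => by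
    simpa using congrArg Prod.snd (toLex.injective h))
  refine ⟨ρ, fun i j hij => ?_⟩
  rw [hρ, Prod.Lex.toLex_lt_toLex]
  simp [hij.le]

theorem isStd_iff_lt_iff {α : Type*} [LinearOrder α] {n : ℕ} {ρ : Equiv.Perm (Fin n)}
    {f : Fin n → α} (hf : Function.Injective f) : IsStd ρ f ↔ ∀ i j, ρ i < ρ j ↔ f i < f j := by
  refine ⟨fun h i j => ?_, fun h i j _ => h i j⟩
  rcases lt_trichotomy i j with hij | rfl | hij
  · exact h i j hij
  · simp
  · have h1 := h j i hij
    have h2 : ρ i ≠ ρ j := fun h => hij.ne' (ρ.injective h)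
    have h3 : f i ≠ f j := fun h => hij.ne' (hf h)
    rw [← not_iff_not, not_lt, not_lt, ← h2.symm.le_iff_lt.symm, h3.symm.le_iff_lt, h1]

theorem IsStd.eq {α : Type*} [LT α] {n : ℕ} {ρ ρ' : Equiv.Perm (Fin n)} {x : Fin n → α}
    (h : IsStd ρ x) (h' : IsStd ρ' x) : ρ = ρ' :=
  perm_eq_of_lt_iff ((isStd_iff_lt_iff ρ'.injective).1 fun i j hij => (h i j hij).trans (h' i j hij).symm)

/-! ### Shuffles -/

theorem perm_apply_inv {n : ℕ} (σ : Equiv.Perm (Fin n)) (i : Fin n) : σ (σ⁻¹ i) = i := by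
  simp


@[simp] theorem concat_castAdd {n m : ℕ} (σ : Equiv.Perm (Fin n)) (τ : Equiv.Perm (Fin m))
    (i : Fin n) : concat σ τ (Fin.castAdd m i) = Fin.castAdd m (σ i) := by
  simp [concat, Equiv.permCongr_apply]

@[simp] theorem concat_natAdd {n m : ℕ} (σ : Equiv.Perm (Fin n)) (τ : Equiv.Perm (Fin m))
    (i : Fin m) : concat σ τ (Fin.natAdd n i) = Fin.natAdd n (τ i) := by
  simp [concat, Equiv.permCongr_apply]

theorem strictMono_iff_lt_iff {α : Type*} [LinearOrder α] {n : ℕ} {f g : Fin n → α} (σ : Equiv.Perm (Fin n))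
    (h : ∀ i, f (σ i) = g i) : StrictMono f ↔ ∀ i j, σ i < σ j ↔ g i < g j := by
  refine ⟨fun hf i j => by rw [← h, ← h, hf.lt_iff_lt], fun hf i j hij => ?_⟩
  have := (hf (σ⁻¹ i) (σ⁻¹ j)).1 (by simpa using hij)
  rw [← h, ← h] at this
  simpa using this

/-- Passing from `ω` to `ρ = ω ∘ (σ × τ)` turns the shuffle condition into a statement on the
relative orders in the two halves of the word `ρ`. -/
theorem isShuffle_iff {n m : ℕ} {σ : Equiv.Perm (Fin n)} {τ : Equiv.Perm (Fin m)}
    {ω ρ : Equiv.Perm (Fin (n + m))} (h : ω * concat σ τ = ρ) :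
    IsShuffle n m ω ↔
      (∀ i j, σ i < σ j ↔ ρ (Fin.castAdd m i) < ρ (Fin.castAdd m j)) ∧
        ∀ i j, τ i < τ j ↔ ρ (Fin.natAdd n i) < ρ (Fin.natAdd n j) := by
  subst h
  exact and_congr (strictMono_iff_lt_iff σ fun i => by simp)
    (strictMono_iff_lt_iff τ fun i => by simp)

/-- A shuffle increases on each block, so it takes its largest value at the end of one of them. The
existential form says that this is the first block, whatever place `σ` gives to the maximum. -/
theorem isShuffle₂_iff {n m : ℕ} (hn : 0 < n) {σ : Equiv.Perm (Fin n)} {τ : Equiv.Perm (Fin m)}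
    {ω ρ : Equiv.Perm (Fin (n + m))} (h : ω * concat σ τ = ρ) :
    IsShuffle₂ n m ω ↔ IsShuffle n m ω ∧
      ∃ i, ∀ j, ρ (Fin.natAdd n j) < ρ (Fin.castAdd m i) := by
  subst h
  obtain ⟨n, rfl⟩ := Nat.exists_eq_add_one_of_ne_zero hn.ne'
  refine and_congr_right fun hω => ⟨fun h => ?_, fun ⟨i, hi⟩ p hp => ?_⟩
  · refine ⟨σ⁻¹ (Fin.last n), fun j => ?_⟩
    have h1 := h (Fin.castAdd m (Fin.last n)) (by simp)
    have h2 : ω (Fin.natAdd (n + 1) (τ j)) ≠ ω (Fin.castAdd m (Fin.last n)) := by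
      rw [ne_eq, ω.injective.eq_iff, Fin.ext_iff]
      simp; omega
    rw [ne_eq, Fin.ext_iff] at h2
    simp only [Equiv.Perm.mul_apply, concat_castAdd, concat_natAdd, perm_apply_inv]
    rw [Fin.lt_def]
    omega
  · have hp' : p = Fin.castAdd m (Fin.last n) := Fin.ext (by simp; omega)
    have h1 : ∀ q, ω q ≤ ω p := fun q => by
      subst hp'
      refine q.addCases (fun i => hω.1.monotone (Fin.le_last i)) fun j => ?_
      have := hi (τ⁻¹ j)
      simp only [Equiv.Perm.mul_apply, concat_castAdd, concat_natAdd,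
        perm_apply_inv] at this
      exact this.le.trans (hω.1.monotone (Fin.le_last _))
    -- The old `n` is now `n + 1`, so `n + m` is the top value. Applying the bound at its preimage
    -- shows that `ω p` is this value.
    have h2 := h1 (ω⁻¹ ⟨n + m, by omega⟩)
    rw [perm_apply_inv, Fin.le_def] at h2
    have := (ω p).2
    simp only at h2
    omega

theorem isShuffle₁_iff {n m : ℕ} (hm : 0 < m) {σ : Equiv.Perm (Fin n)} {τ : Equiv.Perm (Fin m)}
    {ω ρ : Equiv.Perm (Fin (n + m))} (h : ω * concat σ τ = ρ) :
    IsShuffle₁ n m ω ↔ IsShuffle n m ω ∧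
      ∃ j, ∀ i, ρ (Fin.castAdd m i) < ρ (Fin.natAdd n j) := by
  subst h
  obtain ⟨m, rfl⟩ := Nat.exists_eq_add_one_of_ne_zero hm.ne'
  refine and_congr_right fun hω => ⟨fun h => ?_, fun ⟨i, hi⟩ p hp => ?_⟩
  · refine ⟨τ⁻¹ (Fin.last m), fun j => ?_⟩
    have h1 := h (Fin.natAdd n (Fin.last m)) (by simp; omega)
    have h2 : ω (Fin.castAdd (m + 1) (σ j)) ≠ ω (Fin.natAdd n (Fin.last m)) := by
      rw [ne_eq, ω.injective.eq_iff, Fin.ext_iff]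
      simp; omega
    rw [ne_eq, Fin.ext_iff] at h2
    simp only [Equiv.Perm.mul_apply, concat_castAdd, concat_natAdd, perm_apply_inv]
    rw [Fin.lt_def]
    omega
  · have hp' : p = Fin.natAdd n (Fin.last m) := Fin.ext (by simp; omega)
    have h1 : ∀ q, ω q ≤ ω p := fun q => by
      subst hp'
      refine q.addCases (fun j => ?_) fun i => hω.2.monotone (Fin.le_last i)
      have := hi (σ⁻¹ j)
      simp only [Equiv.Perm.mul_apply, concat_castAdd, concat_natAdd,
        perm_apply_inv] at this
      exact this.le.trans (hω.2.monotone (Fin.le_last _))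
    have h2 := h1 (ω⁻¹ ⟨n + m, by omega⟩)
    rw [perm_apply_inv, Fin.le_def] at h2
    have := (ω p).2
    simp only at h2
    omega

section Words

/-! ### The dendriform algebra of functions on words -/

theorem isDendHom_of_basis {k X E : Type*} [CommSemiring k] [AddCommMonoid E] [Module k E]
    {P : DendOps k (X →₀ k)} {Q : DendOps k E} {f : (X →₀ k) →ₗ[k] E}
    (hp : ∀ x y, f (P.prec (Finsupp.single x 1) (Finsupp.single y 1)) =
      Q.prec (f (Finsupp.single x 1)) (f (Finsupp.single y 1)))
    (hs : ∀ x y, f (P.succ (Finsupp.single x 1) (Finsupp.single y 1)) =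
      Q.succ (f (Finsupp.single x 1)) (f (Finsupp.single y 1))) : IsDendHom P Q f where
  map_prec x y := by
    have : P.prec.compr₂ f = Q.prec.compl₁₂ f f := by
      ext x y; simpa using hp x y
    simpa using LinearMap.congr_fun₂ this x y
  map_succ x y := by
    have : P.succ.compr₂ f = Q.succ.compl₁₂ f f := by
      ext x y; simpa using hs x y
    simpa using LinearMap.congr_fun₂ this x y

/-- Lets permutations and trees inherit the axioms from functions on words. -/
theorem IsDendHom.isDendriform {k D E : Type*} [CommSemiring k] [AddCommMonoid D] [Module k D]
    [AddCommMonoid E] [Module k E] {P : DendOps k D} {Q : DendOps k E} {f : D →ₗ[k] E}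
    (hf : IsDendHom P Q f) (hQ : Q.IsDendriform) (hi : Function.Injective f) :
    P.IsDendriform where
  prec_prec a b c := hi (by simp only [hf.map_prec, hf.map_succ, map_add, hQ.prec_prec])
  succ_prec a b c := hi (by simp only [hf.map_prec, hf.map_succ, hQ.succ_prec])
  succ_succ a b c := hi (by
    simp only [hf.map_prec, hf.map_succ, map_add, LinearMap.add_apply, hQ.succ_succ])

@[simp] theorem bilin_single {k X D : Type*} [CommSemiring k] [AddCommMonoid D] [Module k D]
    (f : X → X → D) (x y : X) :
    bilin k f (Finsupp.single x 1) (Finsupp.single y 1) = f x y := by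
  simp [bilin]

/-- The largest letter of a word (`0` for the empty word). -/
def topLetter (w : List ℕ) : ℕ := w.foldr max 0

theorem topLetter_append (u v : List ℕ) : topLetter (u ++ v) = max (topLetter u) (topLetter v) := by
  induction u with
  | nil => simp [topLetter]
  | cons a u ih =>
    simp only [topLetter, List.cons_append, List.foldr_cons] at ih ⊢
    rw [ih, max_assoc]

theorem le_topLetter {w : List ℕ} {a : ℕ} (h : a ∈ w) : a ≤ topLetter w := by
  obtain ⟨u, v, rfl⟩ := List.append_of_mem h
  rw [topLetter_append]
  exact le_max_of_le_right (le_max_left _ _)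

theorem topLetter_mem {w : List ℕ} (h : w ≠ []) : topLetter w ∈ w := by
  obtain ⟨x, l, rfl⟩ := List.exists_cons_of_ne_nil h
  exact foldr_max_mem x l

variable {k : Type*} [CommSemiring k]

/-- The convolution of functions on words, restricted to the splittings that satisfy `c`. -/
def wordConv (c : List ℕ → List ℕ → Prop) [DecidableRel c] (f g : List ℕ → k) (w : List ℕ) : k :=
  ∑ i ∈ Finset.range (w.length + 1),
    if c (w.take i) (w.drop i) then f (w.take i) * g (w.drop i) else 0

/-- Both sides sum `f x * g y * h z` over factorizations `w = xyz`, and `hc` says that they keep the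
same triples. -/
theorem wordConv_assoc (c₁ c₂ c₃ c₄ : List ℕ → List ℕ → Prop) [DecidableRel c₁] [DecidableRel c₂]
    [DecidableRel c₃] [DecidableRel c₄]
    (hc : ∀ x y z, c₂ x y ∧ c₁ (x ++ y) z ↔ c₃ y z ∧ c₄ x (y ++ z)) (f g h : List ℕ → k) :
    wordConv c₁ (wordConv c₂ f g) h = wordConv c₄ f (wordConv c₃ g h) := by
  funext w
  -- The term of the two cuts `j ≤ i`; the two sides differ only in the order of summation.
  let T : ℕ → ℕ → k := fun j i =>
    if c₂ (w.take j) ((w.take i).drop j) ∧ c₁ (w.take i) (w.drop i) then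
      f (w.take j) * g ((w.take i).drop j) * h (w.drop i) else 0
  have h1 : wordConv c₁ (wordConv c₂ f g) h w =
      ∑ i ∈ Finset.Ico 0 (w.length + 1), ∑ j ∈ Finset.Ico 0 (i + 1), T j i := by
    rw [wordConv, Finset.range_eq_Ico]
    refine Finset.sum_congr rfl fun i hi => ?_
    rw [Finset.mem_Ico] at hi
    rw [wordConv, List.length_take, min_eq_left (by omega), ← Finset.range_eq_Ico, Finset.sum_mul]
    by_cases h1 : c₁ (w.take i) (w.drop i)
    · rw [if_pos h1]
      refine Finset.sum_congr rfl fun j hj => ?_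
      rw [Finset.mem_range] at hj
      simp only [T, h1, and_true, ite_mul, zero_mul, List.take_take, min_eq_left (by omega : j ≤ i)]
    · simp [T, h1]
  have h2 : wordConv c₄ f (wordConv c₃ g h) w =
      ∑ j ∈ Finset.Ico 0 (w.length + 1), ∑ i ∈ Finset.Ico j (w.length + 1), T j i := by
    rw [wordConv, Finset.range_eq_Ico]
    refine Finset.sum_congr rfl fun j hj => ?_
    rw [Finset.mem_Ico] at hj
    rw [Finset.sum_Ico_eq_sum_range, wordConv, List.length_drop,
      show w.length - j + 1 = w.length + 1 - j by omega, Finset.mul_sum]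
    have h3 : ∀ i, T j (j + i) =
        if c₃ ((w.drop j).take i) ((w.drop j).drop i) ∧ c₄ (w.take j) (w.drop j) then
        f (w.take j) * (g ((w.drop j).take i) * h ((w.drop j).drop i)) else 0 := fun i => by
      have e1 : (w.take (j + i)).drop j = (w.drop j).take i := by
        rw [List.drop_take]; simp
      have e2 : w.take j ++ (w.drop j).take i = w.take (j + i) := by
        rw [List.take_add]
      have e3 := hc (w.take j) ((w.drop j).take i) ((w.drop j).drop i)
      rw [e2, List.take_append_drop, List.drop_drop] at e3
      simp only [T, e1, List.drop_drop, mul_assoc, e3]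
    by_cases h4 : c₄ (w.take j) (w.drop j)
    · rw [if_pos h4]
      refine Finset.sum_congr rfl fun i hi => ?_
      rw [h3]
      simp [h4]
    · simp [h3, h4]
  rw [h1, h2, Finset.sum_Ico_Ico_comm]

/-- The bilinear map `wordConv c`. -/
def wordConvBilin (k : Type*) [CommSemiring k] (c : List ℕ → List ℕ → Prop) [DecidableRel c] :
    (List ℕ → k) →ₗ[k] (List ℕ → k) →ₗ[k] (List ℕ → k) :=
  LinearMap.mk₂ k (wordConv c)
    (fun f f' g => funext fun w => by
      simp only [wordConv, Pi.add_apply, ← Finset.sum_add_distrib]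
      exact Finset.sum_congr rfl fun i _ => by split_ifs <;> simp [add_mul])
    (fun a f g => funext fun w => by
      simp only [wordConv, Pi.smul_apply, smul_eq_mul, Finset.mul_sum]
      exact Finset.sum_congr rfl fun i _ => by split_ifs <;> simp [mul_assoc])
    (fun f g g' => funext fun w => by
      simp only [wordConv, Pi.add_apply, ← Finset.sum_add_distrib]
      exact Finset.sum_congr rfl fun i _ => by split_ifs <;> simp [mul_add])
    (fun a f g => funext fun w => by
      simp only [wordConv, Pi.smul_apply, smul_eq_mul, Finset.mul_sum]
      exact Finset.sum_congr rfl fun i _ => by split_ifs <;> simp [mul_left_comm])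

/-- The dendriform structure on functions on words: the convolution product is split according to
the position of the leftmost occurrence of the largest letter. -/
def wordDend (k : Type*) [CommSemiring k] : DendOps k (List ℕ → k) where
  prec := wordConvBilin k fun u v => topLetter v ≤ topLetter u
  succ := wordConvBilin k fun u v => topLetter u < topLetter v

theorem wordDend_prec_add_succ (f g : List ℕ → k) :
    (wordDend k).prec f g + (wordDend k).succ f g = wordConv (fun _ _ => True) f g := by
  funext w
  change wordConv (fun u v => topLetter v ≤ topLetter u) f g w +
    wordConv (fun u v => topLetter u < topLetter v) f g w = _
  simp only [wordConv, ← Finset.sum_add_distrib]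
  refine Finset.sum_congr rfl fun i _ => ?_
  rcases le_or_gt (topLetter (w.drop i)) (topLetter (w.take i)) with h | h
  · simp [h, not_lt.2 h]
  · simp [h, not_le.2 h]

theorem wordDend_isDendriform : (wordDend k).IsDendriform where
  prec_prec a b c := by
    rw [wordDend_prec_add_succ]
    refine wordConv_assoc (fun u v => topLetter v ≤ topLetter u)
      (fun u v => topLetter v ≤ topLetter u) (fun _ _ => True)
      (fun u v => topLetter v ≤ topLetter u) (fun x y z => ?_) a b c
    simp only [topLetter_append, max_le_iff, le_max_iff, true_and]
    omega
  succ_prec a b c := by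
    refine wordConv_assoc (fun u v => topLetter v ≤ topLetter u)
      (fun u v => topLetter u < topLetter v) (fun u v => topLetter v ≤ topLetter u)
      (fun u v => topLetter u < topLetter v) (fun x y z => ?_) a b c
    simp only [topLetter_append, le_max_iff, lt_max_iff]
    omega
  succ_succ a b c := by
    rw [wordDend_prec_add_succ]
    refine (wordConv_assoc (fun u v => topLetter u < topLetter v) (fun _ _ => True)
      (fun u v => topLetter u < topLetter v) (fun u v => topLetter u < topLetter v)
      (fun x y z => ?_) a b c).symm
    simp only [topLetter_append, max_lt_iff, lt_max_iff, true_and]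
    omega

/-! ### Permutations as functions on words -/

open Classical in
/-- The indicator function of the words with standardization `p`. -/
noncomputable def permInd (k : Type*) [CommSemiring k] (p : PermIdx) (w : List ℕ) : k :=
  if ∃ x : Fin p.1.1 → ℕ, List.ofFn x = w ∧ IsStd p.1.2 x then 1 else 0

open Classical in
theorem permInd_ofFn {n : ℕ} (hn : 0 < n) (σ : Equiv.Perm (Fin n)) (x : Fin n → ℕ) :
    permInd k (permIdx hn σ) (List.ofFn x) = if IsStd σ x then 1 else 0 := by
  refine if_congr ⟨fun ⟨y, h, hy⟩ => ?_, fun h => ⟨x, rfl, h⟩⟩ rfl rfl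
  rwa [← List.ofFn_injective h]

theorem permInd_of_length_ne {p : PermIdx} {w : List ℕ} (h : w.length ≠ p.1.1) :
    permInd k p w = 0 :=
  if_neg fun ⟨x, hx, _⟩ => h (by rw [← hx, List.length_ofFn])

/-- The linear map which sends a permutation to the indicator function of the words that it
standardizes. -/
noncomputable def permToWord (k : Type*) [CommSemiring k] : PermSpace k →ₗ[k] (List ℕ → k) :=
  Finsupp.linearCombination k (permInd k)

theorem permToWord_single (p : PermIdx) : permToWord k (Finsupp.single p 1) = permInd k p := by
  simp [permToWord]

open Classical in
-- A permutation read as a word is its own standardization. Evaluation at these words is dual to the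
-- basis and recovers all coefficients.
theorem permInd_word (p q : PermIdx) :
    permInd k p (List.ofFn fun i => (q.1.2 i : ℕ)) = if p = q then 1 else 0 := by
  obtain ⟨⟨n, σ⟩, hn⟩ := p
  obtain ⟨⟨m, τ⟩, hm⟩ := q
  by_cases h : n = m
  · subst h
    rw [show (⟨⟨n, σ⟩, hn⟩ : PermIdx) = permIdx hn σ from rfl, permInd_ofFn]
    refine if_congr ⟨fun h => ?_, fun h => ?_⟩ rfl rfl
    · have : σ = τ := perm_eq_of_lt_iff
        ((isStd_iff_lt_iff (Fin.val_injective.comp τ.injective)).1 h)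
      rw [this]
    · have : σ = τ := by simpa using h
      subst this
      exact fun i j _ => Iff.rfl
  · rw [permInd_of_length_ne (by simpa using Ne.symm h), if_neg]
    exact fun h' => h (congrArg (fun p : PermIdx => p.1.1) h')

theorem permToWord_injective : Function.Injective (permToWord k) := by
  intro x y h
  ext q
  have key : ∀ x, permToWord k x (List.ofFn fun i => (q.1.2 i : ℕ)) = x q := fun x => by
    classical
    simp only [permToWord, Finsupp.linearCombination_apply, Finsupp.sum, Finset.sum_apply,
      Pi.smul_apply, permInd_word, smul_eq_mul, mul_ite, mul_one, mul_zero]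
    rw [Finset.sum_ite_eq' x.support q]
    simp [eq_comm]
  rw [← key x, h, key y]

open Classical in
-- Standardizations are unique, so only the `ω` with `ω * concat σ τ = ρ` can contribute.
theorem sum_permInd_mul_concat {n m : ℕ} (hn : 0 < n + m) (σ : Equiv.Perm (Fin n))
    (τ : Equiv.Perm (Fin m)) (c : Equiv.Perm (Fin (n + m)) → Prop) {z : Fin (n + m) → ℕ}
    {ρ : Equiv.Perm (Fin (n + m))} (hρ : IsStd ρ z) :
    ∑ ω : Equiv.Perm (Fin (n + m)) with c ω,
      permInd k (permIdx hn (ω * concat σ τ)) (List.ofFn z) =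
      if c (ρ * (concat σ τ)⁻¹) then 1 else 0 := by
  rw [Finset.sum_filter, Finset.sum_eq_single (ρ * (concat σ τ)⁻¹)]
  · rw [permInd_ofFn, inv_mul_cancel_right, if_pos hρ]
  · intro ω _ hω
    have : ¬ IsStd (ω * concat σ τ) z := fun h => hω (eq_mul_inv_of_mul_eq (h.eq hρ))
    rw [permInd_ofFn, if_neg this, ite_self]
  · simp

/-- The indicators live on words of a single length, so one cut survives. -/
theorem wordConv_permInd (c : List ℕ → List ℕ → Prop) [DecidableRel c] {p q : PermIdx}
    (w : List ℕ) (hw : w.length = p.1.1 + q.1.1) :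
    wordConv c (permInd k p) (permInd k q) w =
      if c (w.take p.1.1) (w.drop p.1.1) then
        permInd k p (w.take p.1.1) * permInd k q (w.drop p.1.1) else 0 := by
  rw [wordConv, Finset.sum_eq_single p.1.1]
  · intro i hi hne
    rw [Finset.mem_range] at hi
    rw [permInd_of_length_ne, zero_mul, ite_self]
    rw [List.length_take]
    omega
  · intro h
    simp at h
    omega

theorem wordConv_permInd_of_length_ne (c : List ℕ → List ℕ → Prop) [DecidableRel c]
    {p q : PermIdx} (w : List ℕ) (hw : w.length ≠ p.1.1 + q.1.1) :
    wordConv c (permInd k p) (permInd k q) w = 0 := by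
  refine Finset.sum_eq_zero fun i hi => ?_
  rw [Finset.mem_range] at hi
  by_cases h : i = p.1.1
  · rw [permInd_of_length_ne (p := q), mul_zero, ite_self]
    rw [List.length_drop]; omega
  · rw [permInd_of_length_ne (p := p), zero_mul, ite_self]
    rw [List.length_take]; omega

theorem isShuffle_iff_isStd {n m : ℕ} {σ : Equiv.Perm (Fin n)} {τ : Equiv.Perm (Fin m)}
    {ω ρ : Equiv.Perm (Fin (n + m))} (h : ω * concat σ τ = ρ) {α : Type*} [LinearOrder α]
    {x : Fin n → α} {y : Fin m → α} (hρ : IsStd ρ (Fin.append x y)) :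
    IsShuffle n m ω ↔ IsStd σ x ∧ IsStd τ y := by
  rw [isShuffle_iff h]
  refine and_congr ?_ ?_
  · refine (isStd_iff_lt_iff (ρ.injective.comp (Fin.castAdd_injective n m))).symm.trans ?_
    refine forall₂_congr fun i j => imp_congr_right fun hij => ?_
    have := hρ (Fin.castAdd m i) (Fin.castAdd m j) (Fin.lt_def.2 hij)
    rw [Fin.append_left, Fin.append_left] at this
    exact iff_congr Iff.rfl this
  · refine (isStd_iff_lt_iff (ρ.injective.comp (Fin.natAdd_injective m n))).symm.trans ?_
    refine forall₂_congr fun i j => imp_congr_right fun hij => ?_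
    have := hρ (Fin.natAdd n i) (Fin.natAdd n j) (by simpa using hij)
    rw [Fin.append_right, Fin.append_right] at this
    exact iff_congr Iff.rfl this

open Classical in
-- Common to both half-products. At a word `xy` with standardization `ρ`, one side tests `ρ (σ ×
-- τ)⁻¹` and the other tests `σ` against `x`, `τ` against `y`, and `c`; `hcd` matches these tests.
theorem sum_permInd_eq_wordConv {n m : ℕ} (hn : 0 < n) (hm : 0 < m) (h : 0 < n + m)
    (σ : Equiv.Perm (Fin n)) (τ : Equiv.Perm (Fin m))
    (d : Equiv.Perm (Fin (n + m)) → Prop) (c : List ℕ → List ℕ → Prop)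
    [DecidableRel c]
    (hcd : ∀ (x : Fin n → ℕ) (y : Fin m → ℕ) (ω ρ : Equiv.Perm (Fin (n + m))),
      IsStd ρ (Fin.append x y) → ω * concat σ τ = ρ →
        (d ω ↔ IsShuffle n m ω ∧ c (List.ofFn x) (List.ofFn y))) :
    ∑ ω : Equiv.Perm (Fin (n + m)) with d ω, permInd k (permIdx h (ω * concat σ τ)) =
      wordConv c (permInd k (permIdx hn σ)) (permInd k (permIdx hm τ)) := by
  funext w
  rw [Finset.sum_apply]
  by_cases hw : w.length = n + m
  · obtain ⟨z, rfl⟩ : ∃ z : Fin (n + m) → ℕ, List.ofFn z = w := by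
      exact ⟨fun i => w.get (i.cast hw.symm), List.ext_get (by simp [hw]) (by simp)⟩
    obtain ⟨x, y, rfl⟩ : ∃ (x : Fin n → ℕ) (y : Fin m → ℕ), Fin.append x y = z :=
      ⟨_, _, Fin.append_castAdd_natAdd⟩
    obtain ⟨ρ, hρ⟩ := exists_isStd (Fin.append x y)
    rw [sum_permInd_mul_concat h _ _ _ hρ, wordConv_permInd _ _ hw, List.ofFn_fin_append,
      List.take_left' (List.length_ofFn), List.drop_left' (List.length_ofFn),
      permInd_ofFn, permInd_ofFn]
    have e := (hcd x y _ ρ hρ (inv_mul_cancel_right _ _)).trans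
      (and_congr_left' (isShuffle_iff_isStd (σ := σ) (τ := τ) (inv_mul_cancel_right _ _) hρ))
    rw [if_congr e rfl rfl]
    split_ifs <;> simp_all
  · rw [wordConv_permInd_of_length_ne _ _ hw]
    exact Finset.sum_eq_zero fun ω _ => permInd_of_length_ne hw

/-- Ties are ranked higher on the left, so the maximum of `ρ` falls in the first half exactly when
the top letter of that half is at least that of the second. Hence the weak inequality in `≺` and the
strict one in `≻`. -/
theorem permToWord_isDendHom : IsDendHom (permDend k) (wordDend k) (permToWord k) := by
  classical
  refine isDendHom_of_basis (fun p q => ?_) fun p q => ?_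
  · obtain ⟨⟨n, σ⟩, hn⟩ := p
    obtain ⟨⟨m, τ⟩, hm⟩ := q
    simp only [permDend, bilin_single, map_sum, permToWord_single]
    refine sum_permInd_eq_wordConv hn hm _ σ τ _ (fun u v => topLetter v ≤ topLetter u)
      fun x y ω ρ hρ h => ?_
    rw [isShuffle₂_iff hn h]
    refine and_congr_right fun _ => ⟨fun ⟨i, hi⟩ => ?_, fun hc => ?_⟩
    · have hy : List.ofFn y ≠ [] := fun h => hm.ne' (by simpa using congrArg List.length h)
      obtain ⟨j, hj⟩ := List.mem_ofFn.1 (topLetter_mem hy)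
      have h1 := hρ (Fin.castAdd m i) (Fin.natAdd n j) (by rw [Fin.lt_def]; simp; omega)
      rw [Fin.append_left, Fin.append_right] at h1
      rw [← hj]
      exact (not_lt.1 fun h2 => lt_asymm (h1.2 h2) (hi j)).trans
        (le_topLetter (List.mem_ofFn.2 ⟨i, rfl⟩))
    · have hx : List.ofFn x ≠ [] := fun h => hn.ne' (by simpa using congrArg List.length h)
      obtain ⟨i, hi⟩ := List.mem_ofFn.1 (topLetter_mem hx)
      refine ⟨i, fun j => ?_⟩
      have hlt : Fin.castAdd m i < Fin.natAdd n j := by rw [Fin.lt_def]; simp; omega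
      have h1 := hρ _ _ hlt
      rw [Fin.append_left, Fin.append_right] at h1
      refine lt_of_le_of_ne (not_lt.1 fun h2 => ?_) (ρ.injective.ne hlt.ne')
      have h3 := h1.1 h2
      rw [hi] at h3
      exact absurd (le_topLetter (List.mem_ofFn.2 ⟨j, rfl⟩)) (not_le.2 (hc.trans_lt h3))
  · obtain ⟨⟨n, σ⟩, hn⟩ := p
    obtain ⟨⟨m, τ⟩, hm⟩ := q
    simp only [permDend, bilin_single, map_sum, permToWord_single]
    refine sum_permInd_eq_wordConv hn hm _ σ τ _ (fun u v => topLetter u < topLetter v)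
      fun x y ω ρ hρ h => ?_
    rw [isShuffle₁_iff hm h]
    have h1 : ∀ i j, ρ (Fin.castAdd m i) < ρ (Fin.natAdd n j) ↔ x i < y j := fun i j => by
      have := hρ (Fin.castAdd m i) (Fin.natAdd n j) (by rw [Fin.lt_def]; simp; omega)
      rwa [Fin.append_left, Fin.append_right] at this
    simp only [h1]
    refine and_congr_right fun _ => ⟨fun ⟨j, hj⟩ => ?_, fun hc => ?_⟩
    · have hx : List.ofFn x ≠ [] := fun h => hn.ne' (by simpa using congrArg List.length h)
      obtain ⟨i, hi⟩ := List.mem_ofFn.1 (topLetter_mem hx)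
      rw [← hi]
      exact (hj i).trans_le (le_topLetter (List.mem_ofFn.2 ⟨j, rfl⟩))
    · have hy : List.ofFn y ≠ [] := fun h => hm.ne' (by simpa using congrArg List.length h)
      obtain ⟨j, hj⟩ := List.mem_ofFn.1 (topLetter_mem hy)
      refine ⟨j, fun i => ?_⟩
      rw [hj]
      exact (le_topLetter (List.mem_ofFn.2 ⟨i, rfl⟩)).trans_lt hc

theorem permDend_isDendriform : (permDend k).IsDendriform :=
  permToWord_isDendHom.isDendriform wordDend_isDendriform permToWord_injective

/-! ### The tree of a word -/

theorem topLetter_le {w : List ℕ} {m : ℕ} (h : ∀ a ∈ w, a ≤ m) : topLetter w ≤ m := by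
  rcases eq_or_ne w [] with rfl | hw
  · exact Nat.zero_le _
  · exact h _ (topLetter_mem hw)

@[simp] theorem treeOfWord_nil : treeOfWord [] = BinaryTree.nil := by rw [treeOfWord]

/-- The hypotheses say that `m` is the leftmost largest letter, where `idxOf` cuts. With
`exists_max_split` this replaces the recursive definition. -/
theorem treeOfWord_append_cons {u v : List ℕ} {m : ℕ} (hu : ∀ a ∈ u, a < m)
    (hv : ∀ b ∈ v, b ≤ m) :
    treeOfWord (u ++ m :: v) = graft (treeOfWord u) (treeOfWord v) := by
  have htop : topLetter (u ++ m :: v) = m := by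
    refine le_antisymm (topLetter_le fun a ha => ?_) (le_topLetter (by simp))
    simp only [List.mem_append, List.mem_cons] at ha
    rcases ha with h | rfl | h
    exacts [(hu a h).le, le_rfl, hv a h]
  have hidx : (u ++ m :: v).idxOf m = u.length := by
    rw [List.idxOf_append_of_notMem fun h => lt_irrefl _ (hu m h), List.idxOf_cons_self, add_zero]
  obtain ⟨x, l, hl⟩ : ∃ x l, u ++ m :: v = x :: l := List.exists_cons_of_ne_nil (by simp)
  rw [hl, treeOfWord, ← hl]
  change graft (treeOfWord (List.take (List.idxOf (topLetter _) _) _))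
    (treeOfWord (List.drop (List.idxOf (topLetter _) _ + 1) _)) = _
  rw [htop, hidx]
  simp

theorem exists_max_split {w : List ℕ} (hw : w ≠ []) :
    ∃ u m v, w = u ++ m :: v ∧ (∀ a ∈ u, a < m) ∧ ∀ b ∈ v, b ≤ m := by
  obtain ⟨u, v, h, hu⟩ := List.eq_append_cons_of_mem (topLetter_mem hw)
  refine ⟨u, topLetter w, v, h, fun a ha => lt_of_le_of_ne (le_topLetter ?_) ?_, fun b hb =>
    le_topLetter ?_⟩
  · rw [h]; simp [ha]
  · rintro rfl; exact hu ha
  · rw [h]; simp [hb]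

theorem treeOfWord_eq_nil {w : List ℕ} : treeOfWord w = BinaryTree.nil ↔ w = [] := by
  refine ⟨fun h => ?_, fun h => by simp [h]⟩
  by_contra hw
  obtain ⟨u, m, v, rfl, hu, hv⟩ := exists_max_split hw
  rw [treeOfWord_append_cons hu hv] at h
  cases h

theorem numNodes_treeOfWord (w : List ℕ) : (treeOfWord w).numNodes = w.length := by
  induction h : w.length using Nat.strong_induction_on generalizing w with
  | _ n ih =>
    subst h
    rcases eq_or_ne w [] with rfl | hw
    · simp
    · obtain ⟨u, m, v, rfl, hu, hv⟩ := exists_max_split hw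
      rw [treeOfWord_append_cons hu hv, graft, BinaryTree.numNodes,
        ih _ (by simp) u rfl, ih _ (by simp; omega) v rfl]
      simp; omega

theorem exists_treeOfWord_eq (t : PBT) : ∃ w, treeOfWord w = t := by
  induction t with
  | nil => exact ⟨[], by simp⟩
  | node _ s t hs ht =>
    obtain ⟨u, rfl⟩ := hs
    obtain ⟨v, rfl⟩ := ht
    -- Any letter above all those of `u` and `v` can serve as the root.
    refine ⟨u ++ (topLetter u + topLetter v + 1) :: v, treeOfWord_append_cons (fun a ha => ?_)
      fun b hb => ?_⟩
    · have := le_topLetter ha; omega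
    · have := le_topLetter hb; omega

/-- The comparisons of earlier with later letters determine the position of the leftmost maximum,
hence by induction the tree. A single list of pairs keeps the two words aligned when they are cut.
-/
theorem treeOfWord_map_fst_eq_map_snd (l : List (ℕ × ℕ))
    (hl : l.Pairwise fun a b => a.1 < b.1 ↔ a.2 < b.2) :
    treeOfWord (l.map Prod.fst) = treeOfWord (l.map Prod.snd) := by
  induction h : l.length using Nat.strong_induction_on generalizing l with
  | _ n ih =>
    subst h
    rcases eq_or_ne l [] with rfl | hne
    · rfl
    · obtain ⟨u, m, v, huv, hu, hv⟩ := exists_max_split (w := l.map Prod.fst) (by simpa using hne)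
      obtain ⟨l₁, l', rfl, rfl, h'⟩ := List.map_eq_append_iff.1 huv
      obtain ⟨p, l₂, rfl, rfl, rfl⟩ := List.map_eq_cons_iff.1 h'
      rw [List.pairwise_append, List.pairwise_cons] at hl
      obtain ⟨h₁, ⟨hp, h₂⟩, h₁₂⟩ := hl
      have hu' : ∀ a ∈ l₁.map Prod.snd, a < p.2 := by
        simp only [List.mem_map, forall_exists_index, and_imp, forall_apply_eq_imp_iff₂] at hu ⊢
        exact fun a ha => (h₁₂ a ha p (by simp)).1 (hu a ha)
      have hv' : ∀ b ∈ l₂.map Prod.snd, b ≤ p.2 := by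
        simp only [List.mem_map, forall_exists_index, and_imp, forall_apply_eq_imp_iff₂] at hv ⊢
        exact fun b hb => not_lt.1 fun h => not_le.2 ((hp b hb).2 h) (hv b hb)
      rw [List.map_append, List.map_append, List.map_cons, List.map_cons,
        treeOfWord_append_cons hu hv, treeOfWord_append_cons hu' hv',
        ih _ (by simp) l₁ h₁ rfl, ih _ (by simp; omega) l₂ h₂ rfl]

theorem IsStd.psi_eq {n : ℕ} {σ : Equiv.Perm (Fin n)} {x : Fin n → ℕ} (h : IsStd σ x) :
    psi σ = treeOfWord (List.ofFn x) := by
  have := treeOfWord_map_fst_eq_map_snd (List.ofFn fun i => ((σ i : ℕ), x i))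
    (List.pairwise_ofFn.2 fun i j hij => h i j hij)
  simpa [List.map_ofFn, Function.comp_def, psi] using this

/-! ### Trees as functions on words -/

/-- The indicator function of the words with tree `t`. -/
def treeInd (k : Type*) [CommSemiring k] (t : PBT) (w : List ℕ) : k :=
  if treeOfWord w = t then 1 else 0

theorem treeInd_nil_of_ne {t : PBT} (ht : t ≠ BinaryTree.nil) : treeInd k t [] = 0 :=
  if_neg (by simpa using ht.symm)

theorem treeInd_nil_of_ne_nil {w : List ℕ} (hw : w ≠ []) : treeInd k BinaryTree.nil w = 0 :=
  if_neg (by simpa [treeOfWord_eq_nil] using hw)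

theorem treeInd_graft {u v : List ℕ} {m : ℕ} (hu : ∀ a ∈ u, a < m) (hv : ∀ b ∈ v, b ≤ m)
    (s t : PBT) : treeInd k (graft s t) (u ++ m :: v) = treeInd k s u * treeInd k t v := by
  rw [treeInd, treeOfWord_append_cons hu hv]
  simp only [treeInd, mul_ite, mul_one, mul_zero, graft, BinaryTree.node.injEq, true_and]
  split_ifs <;> simp_all

/-- Only the cuts after `m` count. An empty left factor has top letter `0` by convention and would
be wrongly accepted when `m = 0`; `hf` kills this term. -/
theorem wordDend_prec_append_cons {u v : List ℕ} {m : ℕ} (hu : ∀ a ∈ u, a < m)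
    (hv : ∀ b ∈ v, b ≤ m) (f g : List ℕ → k) (hf : f [] = 0) :
    (wordDend k).prec f g (u ++ m :: v) =
      ∑ i ∈ Finset.range (v.length + 1), f (u ++ m :: v.take i) * g (v.drop i) := by
  change wordConv (fun u v => topLetter v ≤ topLetter u) f g (u ++ m :: v) = _
  rw [wordConv, List.length_append, List.length_cons, add_right_comm, Finset.sum_range_add,
    Finset.sum_eq_zero, zero_add]
  · refine Finset.sum_congr rfl fun i _ => ?_
    rw [add_assoc, List.take_length_add_append, List.drop_length_add_append, add_comm 1 i,
      List.take_succ_cons, List.drop_succ_cons, if_pos]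
    exact (topLetter_le fun b hb => hv b (List.mem_of_mem_drop hb)).trans (le_topLetter (by simp))
  · intro i hi
    rw [Finset.mem_range] at hi
    rw [List.take_append_of_le_length (by omega), List.drop_append_of_le_length (by omega)]
    rcases eq_or_ne (u.take i) [] with h | h
    · simp [h, hf]
    · rw [if_neg]
      rw [not_le]
      exact (hu _ (List.mem_of_mem_take (topLetter_mem h))).trans_le (le_topLetter (by simp))

theorem wordDend_succ_append_cons {u v : List ℕ} {m : ℕ} (hu : ∀ a ∈ u, a < m)
    (hv : ∀ b ∈ v, b ≤ m) (f g : List ℕ → k) (hf : f [] = 0) :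
    (wordDend k).succ f g (u ++ m :: v) =
      ∑ i ∈ Finset.range (u.length + 1), f (u.take i) * g (u.drop i ++ m :: v) := by
  change wordConv (fun u v => topLetter u < topLetter v) f g (u ++ m :: v) = _
  rw [wordConv, List.length_append, List.length_cons, add_right_comm, Finset.sum_range_add,
    add_comm, Finset.sum_eq_zero, zero_add]
  · refine Finset.sum_congr rfl fun i hi => ?_
    rw [Finset.mem_range] at hi
    rw [List.take_append_of_le_length (by omega), List.drop_append_of_le_length (by omega)]
    -- If `m = 0`, the empty left factor fails the strict inequality, but its term vanishes by `hf`.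
    rcases eq_or_ne (u.take i) [] with h | h
    · simp [h, hf]
    · rw [if_pos]
      exact (hu _ (List.mem_of_mem_take (topLetter_mem h))).trans_le (le_topLetter (by simp))
  · intro i _
    rw [add_assoc, List.take_length_add_append, List.drop_length_add_append, add_comm 1 i,
      List.take_succ_cons, List.drop_succ_cons, if_neg]
    rw [not_lt]
    exact (topLetter_le fun b hb => hv b (List.mem_of_mem_drop hb)).trans (le_topLetter (by simp))

/-- The convolution product of functions on words. -/
def wordMul (f g : List ℕ → k) (w : List ℕ) : k :=
  ∑ i ∈ Finset.range (w.length + 1), f (w.take i) * g (w.drop i)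

theorem wordMul_eq (f g : List ℕ → k) :
    wordMul f g = (wordDend k).prec f g + (wordDend k).succ f g := by
  rw [wordDend_prec_add_succ]
  funext w
  simp [wordMul, wordConv]

/-- The word form of `(s ∨ t) ≺ g = s ∨ (t * g)`: the cuts after `m` leave the left subtree
untouched. -/
theorem wordDend_prec_treeInd {u v : List ℕ} {m : ℕ} (hu : ∀ a ∈ u, a < m)
    (hv : ∀ b ∈ v, b ≤ m) (s t : PBT) (g : List ℕ → k) :
    (wordDend k).prec (treeInd k (graft s t)) g (u ++ m :: v) =
      treeInd k s u * wordMul (treeInd k t) g v := by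
  rw [wordDend_prec_append_cons hu hv _ _ (treeInd_nil_of_ne (by simp)), wordMul, Finset.mul_sum]
  refine Finset.sum_congr rfl fun i _ => ?_
  rw [treeInd_graft hu fun b hb => hv b (List.mem_of_mem_take hb), mul_assoc]

theorem wordDend_succ_treeInd {u v : List ℕ} {m : ℕ} (hu : ∀ a ∈ u, a < m)
    (hv : ∀ b ∈ v, b ≤ m) (s t : PBT) (f : List ℕ → k) (hf : f [] = 0) :
    (wordDend k).succ f (treeInd k (graft s t)) (u ++ m :: v) =
      wordMul f (treeInd k s) u * treeInd k t v := by
  rw [wordDend_succ_append_cons hu hv _ _ hf, wordMul, Finset.sum_mul]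
  refine Finset.sum_congr rfl fun i _ => ?_
  rw [treeInd_graft (fun b hb => hu b (List.mem_of_mem_drop hb)) hv, mul_assoc]

theorem mapDomain_graft_right (p : PBT →₀ k) (a b l : PBT) :
    p.mapDomain (fun r => graft l r) (graft a b) = (if a = l then 1 else 0) * p b := by
  have hinj : Function.Injective fun r => graft l r := fun r r' h => by
    simpa [graft] using h
  by_cases h : a = l
  · subst h
    rw [if_pos rfl, one_mul]
    exact Finsupp.mapDomain_apply hinj p b
  · rw [if_neg h, zero_mul]
    refine Finsupp.mapDomain_of_notMem_range _ _ fun ⟨r, hr⟩ => h ?_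
    simp only [graft, BinaryTree.node.injEq, true_and] at hr
    exact hr.1.symm

theorem mapDomain_graft_left (p : PBT →₀ k) (a b r : PBT) :
    p.mapDomain (fun l => graft l r) (graft a b) = p a * (if b = r then 1 else 0) := by
  have hinj : Function.Injective fun l => graft l r := fun l l' h => by
    simpa [graft] using h
  by_cases h : b = r
  · subst h
    rw [if_pos rfl, mul_one]
    exact Finsupp.mapDomain_apply hinj p a
  · rw [if_neg h, mul_zero]
    refine Finsupp.mapDomain_of_notMem_range _ _ fun ⟨l, hl⟩ => h ?_
    simp only [graft, BinaryTree.node.injEq, true_and] at hl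
    exact hl.2.symm

/-- The product of trees is convolution of indicators. Splitting `w` at its leftmost maximum
reproduces the two terms of the recursion as the two half-products; if a factor is `|`, only an
extreme cut survives. -/
theorem treeMul_apply_treeOfWord (s t : PBT) (w : List ℕ) :
    treeMul k s t (treeOfWord w) = wordMul (treeInd k s) (treeInd k t) w := by
  induction s, t using treeMul.induct generalizing w with
  | case1 t =>
    rw [treeMul, wordMul, Finset.sum_eq_single 0]
    · simp [treeInd, Finsupp.single_apply, eq_comm]
    · intro i hi h0
      rw [Finset.mem_range] at hi
      rw [treeInd_nil_of_ne_nil, zero_mul]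
      rw [ne_eq, ← List.length_eq_zero_iff, List.length_take]
      omega
    · simp
  | case2 x s₁ s₂ =>
    rw [treeMul, wordMul, Finset.sum_eq_single w.length]
    · simp [treeInd, Finsupp.single_apply, eq_comm]
    · intro i hi h0
      rw [Finset.mem_range] at hi
      rw [treeInd_nil_of_ne_nil, mul_zero]
      rw [ne_eq, ← List.length_eq_zero_iff, List.length_drop]
      omega
    · simp
  | case3 x s₁ s₂ y t₁ t₂ ih₁ ih₂ =>
    have hs : treeInd k (BinaryTree.node x s₁ s₂) [] = 0 := treeInd_nil_of_ne (by simp)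
    rcases eq_or_ne w [] with rfl | hw
    · rw [treeMul, treeOfWord_nil, Finsupp.add_apply, Finsupp.mapDomain_of_notMem_range,
        Finsupp.mapDomain_of_notMem_range]
      · simp [wordMul, hs]
      · simp [graft]
      · simp [graft]
    · obtain ⟨u, m, v, rfl, hu, hv⟩ := exists_max_split hw
      rw [treeMul, wordMul_eq, treeOfWord_append_cons hu hv, Finsupp.add_apply,
        mapDomain_graft_right, mapDomain_graft_left, ih₁, ih₂, Pi.add_apply]
      congr 1
      · exact (wordDend_prec_treeInd hu hv s₁ s₂ _).symm
      · exact (wordDend_succ_treeInd hu hv t₁ t₂ _ hs).symm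

/-- The linear map which sends a tree to the indicator function of the words with this tree. -/
def treeToWord (k : Type*) [CommSemiring k] : TreeSpace k →ₗ[k] (List ℕ → k) where
  toFun x w := if h : treeOfWord w = BinaryTree.nil then 0 else x ⟨treeOfWord w, h⟩
  map_add' x y := by
    funext w
    by_cases h : treeOfWord w = BinaryTree.nil <;> simp [h]
  map_smul' c x := by
    funext w
    by_cases h : treeOfWord w = BinaryTree.nil <;> simp [h]

theorem treeToWord_nil (x : TreeSpace k) : treeToWord k x [] = 0 := by
  simp [treeToWord]

theorem treeToWord_append_cons {u v : List ℕ} {m : ℕ} (hu : ∀ a ∈ u, a < m)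
    (hv : ∀ b ∈ v, b ≤ m) (x : TreeSpace k) :
    treeToWord k x (u ++ m :: v) = x (graft' (treeOfWord u) (treeOfWord v)) := by
  have h := treeOfWord_append_cons hu hv
  simp [treeToWord, h, graft']

theorem treeToWord_single (t : TreeIdx) :
    treeToWord k (Finsupp.single t 1) = treeInd k t.1 := by
  funext w
  by_cases h : treeOfWord w = BinaryTree.nil
  · simp [treeToWord, treeInd, h, t.2.symm]
  · simp only [treeToWord, LinearMap.coe_mk, AddHom.coe_mk, dif_neg h, treeInd,
      Finsupp.single_apply, Subtype.ext_iff]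
    exact if_congr eq_comm rfl rfl

theorem treeToWord_injective : Function.Injective (treeToWord k) := by
  intro x y h
  ext ⟨t, ht⟩
  obtain ⟨w, rfl⟩ := exists_treeOfWord_eq t
  simpa [treeToWord, ht] using congrFun h w

theorem val_mapDomain_graft' {f : PBT → TreeIdx} (p : PBT →₀ k) (t : TreeIdx) :
    p.mapDomain f t = p.mapDomain (fun r => (f r).1) t.1 := by
  rw [show (fun r => (f r).1) = Subtype.val ∘ f from rfl, Finsupp.mapDomain_comp,
    Finsupp.mapDomain_apply Subtype.val_injective]

theorem treeToWord_isDendHom : IsDendHom (treeDend k) (wordDend k) (treeToWord k) := by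
  refine isDendHom_of_basis (fun s t => ?_) fun s t => ?_ <;> funext w <;>
    rw [treeToWord_single, treeToWord_single]
  · obtain ⟨s, hs⟩ := s
    obtain ⟨_, s₁, s₂, rfl⟩ : ∃ x s₁ s₂, s = BinaryTree.node x s₁ s₂ := by
      cases s with
      | nil => exact absurd rfl hs
      | node x s₁ s₂ => exact ⟨x, s₁, s₂, rfl⟩
    rcases eq_or_ne w [] with rfl | hw
    · rw [treeToWord_nil]
      simp [wordDend, wordConvBilin, wordConv, treeInd_nil_of_ne hs]
    · obtain ⟨u, m, v, rfl, hu, hv⟩ := exists_max_split hw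
      rw [treeToWord_append_cons hu hv]
      refine Eq.trans ?_ (wordDend_prec_treeInd hu hv s₁ s₂ _).symm
      simp only [treeDend, bilin_single]
      rw [val_mapDomain_graft', ← treeMul_apply_treeOfWord]
      exact mapDomain_graft_right _ _ _ _
  · obtain ⟨t, ht⟩ := t
    obtain ⟨_, t₁, t₂, rfl⟩ : ∃ x t₁ t₂, t = BinaryTree.node x t₁ t₂ := by
      cases t with
      | nil => exact absurd rfl ht
      | node x t₁ t₂ => exact ⟨x, t₁, t₂, rfl⟩
    rcases eq_or_ne w [] with rfl | hw
    · rw [treeToWord_nil]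
      simp [wordDend, wordConvBilin, wordConv]
    · obtain ⟨u, m, v, rfl, hu, hv⟩ := exists_max_split hw
      rw [treeToWord_append_cons hu hv]
      refine Eq.trans ?_ (wordDend_succ_treeInd hu hv t₁ t₂ _ (treeInd_nil_of_ne s.2)).symm
      simp only [treeDend, bilin_single]
      rw [val_mapDomain_graft', ← treeMul_apply_treeOfWord]
      exact mapDomain_graft_left _ _ _ _

theorem treeDend_isDendriform : (treeDend k).IsDendriform :=
  treeToWord_isDendHom.isDendriform wordDend_isDendriform treeToWord_injective

/-! ### The map `ψ*` is a dendriform morphism -/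

theorem psiStar_single (t : TreeIdx) : psiStar k (Finsupp.single t 1) =
    ∑ σ : Equiv.Perm (Fin t.1.numNodes) with psi σ = t.1,
      Finsupp.single (permIdx (numNodes_pos t) σ) 1 := by
  classical
  simp only [psiStar, Finsupp.linearCombination_single, one_smul]

/-- The words with tree `t` are partitioned by their standardizations, which are the `σ` with `ψ(σ)
= t`. -/
theorem permToWord_psiStar (x : TreeSpace k) :
    permToWord k (psiStar k x) = treeToWord k x := by
  classical
  refine LinearMap.congr_fun (f := (permToWord k) ∘ₗ (psiStar k)) (g := treeToWord k) ?_ x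
  refine Finsupp.lhom_ext' fun t => LinearMap.ext_ring ?_
  simp only [LinearMap.comp_apply, Finsupp.lsingle_apply, psiStar_single, map_sum,
    permToWord_single, treeToWord_single]
  funext w
  rw [Finset.sum_apply]
  by_cases hw : w.length = t.1.numNodes
  · obtain ⟨z, rfl⟩ : ∃ z : Fin t.1.numNodes → ℕ, List.ofFn z = w :=
      ⟨fun i => w.get (i.cast hw.symm), List.ext_get (by simp [hw]) (by simp)⟩
    obtain ⟨ρ, hρ⟩ := exists_isStd z
    rw [Finset.sum_filter, Finset.sum_eq_single ρ, permInd_ofFn, if_pos hρ, hρ.psi_eq, treeInd]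
    · intro σ _ hσ
      have : ¬ IsStd σ z := fun h => hσ (h.eq hρ)
      rw [permInd_ofFn, if_neg this, ite_self]
    · simp
  · rw [treeInd, if_neg]
    · exact Finset.sum_eq_zero fun σ _ => permInd_of_length_ne hw
    · exact fun h => hw (by rw [← h, numNodes_treeOfWord])

theorem psiStar_isDendHom : IsDendHom (treeDend k) (permDend k) (psiStar k) where
  map_prec x y := permToWord_injective (by
    rw [permToWord_isDendHom.map_prec, permToWord_psiStar, permToWord_psiStar, permToWord_psiStar,
      treeToWord_isDendHom.map_prec])
  map_succ x y := permToWord_injective (by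
    rw [permToWord_isDendHom.map_succ, permToWord_psiStar, permToWord_psiStar, permToWord_psiStar,
      treeToWord_isDendHom.map_succ])

theorem psiStar_treeY :
    psiStar k (Finsupp.single treeY 1) = Finsupp.single (permIdx Nat.one_pos 1) 1 := by
  refine permToWord_injective ?_
  rw [permToWord_psiStar, treeToWord_single, permToWord_single]
  funext w
  by_cases hw : w.length = 1
  · obtain ⟨a, rfl⟩ := List.length_eq_one_iff.1 hw
    have h1 : [a] = List.ofFn fun _ : Fin 1 => a := by simp
    rw [treeInd, if_pos, h1, permInd_ofFn, if_pos]
    · exact fun i j hij => absurd hij (by simp [Subsingleton.elim i j])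
    · simpa [treeY, graft'] using treeOfWord_append_cons (u := []) (v := []) (m := a) (by simp)
        (by simp)
  · rw [permInd_of_length_ne hw, treeInd, if_neg]
    exact fun h => hw (by rw [← numNodes_treeOfWord, h]; simp [treeY, graft'])

/-! ### The dendriform algebra of trees is generated by the tree with one vertex -/

theorem treeMul_nil_right (s : PBT) : treeMul k s BinaryTree.nil = Finsupp.single s 1 := by
  cases s <;> rw [treeMul]

theorem treeMul_nil_left (t : PBT) : treeMul k BinaryTree.nil t = Finsupp.single t 1 := by
  rw [treeMul]

theorem single_graft'_nil (s : TreeIdx) :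
    (Finsupp.single (graft' s.1 BinaryTree.nil) 1 : TreeSpace k) =
    (treeDend k).succ (Finsupp.single s 1) (Finsupp.single treeY 1) := by
  simp [treeDend, treeY, graft', treeMul_nil_right]

theorem single_graft' (s : PBT) (t : TreeIdx) : (Finsupp.single (graft' s t.1) 1 : TreeSpace k) =
    (treeDend k).prec (Finsupp.single (graft' s BinaryTree.nil) 1) (Finsupp.single t 1) := by
  simp [treeDend, graft', treeMul_nil_left]

/-- Generation by `Y`: `s ∨ t = (s ∨ |) ≺ t` and `s ∨ | = s ≻ Y` reduce to smaller trees, empty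
subtrees being treated apart. -/
theorem IsDendHom.treeSpace_ext {E : Type*} [AddCommMonoid E] [Module k E] {Q : DendOps k E}
    {F F' : TreeSpace k →ₗ[k] E} (hF : IsDendHom (treeDend k) Q F)
    (hF' : IsDendHom (treeDend k) Q F')
    (h : F (Finsupp.single treeY 1) = F' (Finsupp.single treeY 1)) : F = F' := by
  refine Finsupp.lhom_ext' fun t => LinearMap.ext_ring ?_
  simp only [LinearMap.comp_apply, Finsupp.lsingle_apply]
  obtain ⟨t, ht⟩ := t
  induction t with
  | nil => exact absurd rfl ht
  | node _ s t ihs iht =>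
    have h1 : F (Finsupp.single (graft' s BinaryTree.nil) 1) =
        F' (Finsupp.single (graft' s BinaryTree.nil) 1) := by
      by_cases hs : s = BinaryTree.nil
      · subst hs; exact h
      · rw [single_graft'_nil ⟨s, hs⟩, hF.map_succ, hF'.map_succ, ihs hs, h]
    by_cases ht : t = BinaryTree.nil
    · subst ht; exact h1
    · have := single_graft' (k := k) s ⟨t, ht⟩
      change F (Finsupp.single (graft' s t) 1) = F' (Finsupp.single (graft' s t) 1)
      rw [this, hF.map_prec, hF'.map_prec, h1, iht ht]

end Words

section Functions

set_option linter.unusedSectionVars false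

variable {k B : Type*} [RCLike k] [NormedRing B] [NormedAlgebra ℝ B] [NormedAlgebra k B]

/-! ### Primitives of locally integrable functions -/

theorem integrableOn_locInt (f : LocInt k B) (s : ℝ) : IntegrableOn f.1 (Set.Ioo 0 s) := by
  have h : IntegrableOn f.1 (Set.Icc 0 s) halfLine := f.2.integrableOn_isCompact isCompact_Icc
  rw [IntegrableOn, Measure.restrict_restrict measurableSet_Icc] at h
  exact IntegrableOn.mono_set h fun x hx => ⟨⟨hx.1.le, hx.2.le⟩, hx.1⟩

theorem integral_halfLine_congr {f : ℝ → B} {s : ℝ} (hs : 0 ≤ s) :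
    ∫ u in (0 : ℝ)..s, f u ∂halfLine = ∫ u in Set.Ioo 0 s, f u := by
  rw [intervalIntegral.integral_of_le hs, Measure.restrict_restrict measurableSet_Ioc,
    Set.inter_eq_left.2 Set.Ioc_subset_Ioi_self, integral_Ioc_eq_integral_Ioo]

theorem prim_eq (f : LocInt k B) {s : ℝ} (hs : 0 ≤ s) : prim f s = ∫ u in Set.Ioo 0 s, f.1 u :=
  integral_halfLine_congr hs

theorem ae_Ioo_of_ae_halfLine {p : ℝ → Prop} (h : ∀ᵐ x ∂halfLine, p x) (s : ℝ) :
    ∀ᵐ x ∂volume.restrict (Set.Ioo 0 s), p x :=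
  ae_restrict_of_ae_restrict_of_subset Set.Ioo_subset_Ioi_self h

theorem locallyIntegrable_halfLine {f : ℝ → B} (h : ∀ s, IntegrableOn f (Set.Ioo 0 s)) :
    LocallyIntegrable f halfLine := fun x =>
  ⟨Set.Iio (x + 1), Iio_mem_nhds (by linarith), by
    rw [IntegrableOn, Measure.restrict_restrict measurableSet_Iio, Set.Iio_inter_Ioi]
    exact h _⟩

theorem locallyIntegrable_indicator {f : ℝ → B} (hf : LocallyIntegrable f halfLine) :
    LocallyIntegrable ((Set.Ioi 0).indicator f) volume := fun x => by
  obtain ⟨U, hU, hi⟩ := hf x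
  refine ⟨U, hU, ?_⟩
  rw [IntegrableOn, Measure.restrict_restrict' measurableSet_Ioi] at hi
  rw [IntegrableOn, integrable_indicator_iff measurableSet_Ioi, IntegrableOn,
    Measure.restrict_restrict measurableSet_Ioi, Set.inter_comm]
  exact hi

theorem prim_eq_integral_indicator (f : LocInt k B) (s : ℝ) :
    prim f s = ∫ u in (0 : ℝ)..s, (Set.Ioi 0).indicator f.1 u := by
  rw [prim, intervalIntegral, intervalIntegral, integral_indicator measurableSet_Ioi,
    integral_indicator measurableSet_Ioi, Measure.restrict_restrict measurableSet_Ioc,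
    Measure.restrict_restrict measurableSet_Ioc, Measure.restrict_restrict measurableSet_Ioi,
    Measure.restrict_restrict measurableSet_Ioi, Set.inter_comm, Set.inter_comm (Set.Ioc s 0)]

/-- Lebesgue differentiation, applied to the extension of `f` by zero to the whole line. -/
theorem ae_hasDerivAt_prim [CompleteSpace B] (f : LocInt k B) :
    ∀ᵐ s ∂halfLine, HasDerivAt (prim f) (f.1 s) s := by
  filter_upwards [ae_restrict_of_ae
    (_root_.LocallyIntegrable.ae_hasDerivAt_integral (locallyIntegrable_indicator f.2)),
    ae_restrict_mem measurableSet_Ioi] with s hs hpos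
  have := hs 0
  rw [Set.indicator_of_mem hpos] at this
  exact this.congr_of_eventuallyEq (.of_forall fun t => prim_eq_integral_indicator f t)

theorem ae_hasDerivAt_of_prim_eq [CompleteSpace B] {f : LocInt k B} {G : ℝ → B}
    (h : ∀ s, 0 < s → prim f s = G s) : ∀ᵐ s ∂halfLine, HasDerivAt G (f.1 s) s := by
  filter_upwards [ae_hasDerivAt_prim f, ae_restrict_mem measurableSet_Ioi] with s hs hpos
  refine hs.congr_of_eventuallyEq ?_
  filter_upwards [Ioi_mem_nhds hpos] with t ht
  exact (h t ht).symm

theorem locInt_ext_hasDerivAt {f g : LocInt k B} {G : ℝ → B}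
    (hf : ∀ᵐ s ∂halfLine, HasDerivAt G (f.1 s) s) (hg : ∀ᵐ s ∂halfLine, HasDerivAt G (g.1 s) s) :
    f = g := locInt_ext <| by
  filter_upwards [hf, hg] with s h₁ h₂
  exact h₁.unique h₂

/-- A class is almost everywhere the derivative of its primitive, so identities can be checked after
integration. -/
theorem locInt_ext_prim [CompleteSpace B] {f g : LocInt k B}
    (h : ∀ s, 0 < s → prim f s = prim g s) : f = g :=
  locInt_ext_hasDerivAt (ae_hasDerivAt_of_prim_eq h) (ae_hasDerivAt_prim g)

theorem prim_sum {ι : Type*} (t : Finset ι) (f : ι → LocInt k B) (s : ℝ) :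
    prim (∑ i ∈ t, f i) s = ∑ i ∈ t, prim (f i) s := by
  classical
  induction t using Finset.induction_on with
  | empty => simpa using prim_smul (0 : k) (0 : LocInt k B) s
  | insert i t hi ih => rw [Finset.sum_insert hi, Finset.sum_insert hi, prim_add, ih]

/-! ### The dendriform algebra of locally integrable functions -/

theorem prim_funDend_prec (f g : LocInt k B) {s : ℝ} (hs : 0 ≤ s) :
    prim ((funDend k B).prec f g) s = ∫ t in Set.Ioo 0 s, f.1 t * prim g t := by
  rw [prim_eq _ hs]
  exact integral_congr_ae (ae_Ioo_of_ae_halfLine (mulRight_coe f (prim g) (continuous_prim g)) s)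

theorem prim_funDend_succ (f g : LocInt k B) {s : ℝ} (hs : 0 ≤ s) :
    prim ((funDend k B).succ f g) s = ∫ t in Set.Ioo 0 s, prim f t * g.1 t := by
  rw [prim_eq _ hs]
  exact integral_congr_ae (ae_Ioo_of_ae_halfLine (mulLeft_coe (prim f) (continuous_prim f) g) s)

/-- The Rota–Baxter identity. Fubini on the square `(0, s)²`: the part where the second variable is
smaller gives `f ≺ g`, the complement gives `f ≻ g`. -/
theorem prim_mul_prim [CompleteSpace B] (f g : LocInt k B) {s : ℝ} (hs : 0 ≤ s) :
    prim f s * prim g s = prim ((funDend k B).prec f g + (funDend k B).succ f g) s := by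
  set μ : Measure ℝ := volume.restrict (Set.Ioo 0 s) with hμ
  have hf : Integrable f.1 μ := integrableOn_locInt f s
  have hg : Integrable g.1 μ := integrableOn_locInt g s
  have hH : Integrable (fun p : ℝ × ℝ => f.1 p.1 * g.1 p.2) (μ.prod μ) := hf.mul_prod hg
  have hmeas : MeasurableSet {p : ℝ × ℝ | p.2 < p.1} :=
    measurableSet_lt measurable_snd measurable_fst
  have htot : ∫ p, f.1 p.1 * g.1 p.2 ∂μ.prod μ = prim f s * prim g s := by
    rw [integral_prod _ hH]
    simp only [integral_const_mul_of_integrable hg]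
    rw [integral_mul_const_of_integrable hf, prim_eq f hs, prim_eq g hs]
  have h1 : ∫ p in {p : ℝ × ℝ | p.2 < p.1}, f.1 p.1 * g.1 p.2 ∂μ.prod μ =
      ∫ t in Set.Ioo 0 s, f.1 t * prim g t := by
    rw [← integral_indicator hmeas, integral_prod _ (hH.indicator hmeas)]
    refine setIntegral_congr_fun measurableSet_Ioo fun t ht => ?_
    have : ∀ v, {p : ℝ × ℝ | p.2 < p.1}.indicator (fun p => f.1 p.1 * g.1 p.2) (t, v) =
        (Set.Iio t).indicator (fun v => f.1 t * g.1 v) v := fun v => by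
      simp [Set.indicator_apply]
    simp only [this]
    rw [integral_indicator measurableSet_Iio, hμ, Measure.restrict_restrict measurableSet_Iio,
      Set.inter_comm, Set.Ioo_inter_Iio, min_eq_right ht.2.le,
      integral_const_mul_of_integrable (integrableOn_locInt g t), prim_eq g ht.1.le]
  have h2 : ∫ p in {p : ℝ × ℝ | p.2 < p.1}ᶜ, f.1 p.1 * g.1 p.2 ∂μ.prod μ =
      ∫ t in Set.Ioo 0 s, prim f t * g.1 t := by
    rw [← integral_indicator hmeas.compl, integral_prod_symm _ (hH.indicator hmeas.compl)]
    refine setIntegral_congr_fun measurableSet_Ioo fun t ht => ?_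
    have : ∀ v, {p : ℝ × ℝ | p.2 < p.1}ᶜ.indicator (fun p => f.1 p.1 * g.1 p.2) (v, t) =
        (Set.Iic t).indicator (fun v => f.1 v * g.1 t) v := fun v => by
      simp [Set.indicator_apply]
    simp only [this]
    have hset : Set.Iic t ∩ Set.Ioo 0 s = Set.Ioc 0 t := by
      ext x
      simp only [Set.mem_inter_iff, Set.mem_Iic, Set.mem_Ioo, Set.mem_Ioc]
      exact ⟨fun h => ⟨h.2.1, h.1⟩, fun h => ⟨h.2, h.1, h.2.trans_lt ht.2⟩⟩
    rw [integral_indicator measurableSet_Iic, hμ, Measure.restrict_restrict measurableSet_Iic,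
      hset, integral_Ioc_eq_integral_Ioo,
      integral_mul_const_of_integrable (integrableOn_locInt f t), prim_eq f ht.1.le]
  rw [prim_add, prim_funDend_prec f g hs, prim_funDend_succ f g hs, ← htot, ← h1, ← h2,
    integral_add_compl hmeas hH]

theorem funDend_prec_coe (f g : LocInt k B) :
    ((funDend k B).prec f g).1 =ᵐ[halfLine] fun s => f.1 s * prim g s :=
  mulRight_coe f (prim g) (continuous_prim g)

theorem funDend_succ_coe (f g : LocInt k B) :
    ((funDend k B).succ f g).1 =ᵐ[halfLine] fun s => prim f s * g.1 s :=
  mulLeft_coe (prim f) (continuous_prim f) g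

theorem funDend_isDendriform [CompleteSpace B] : (funDend k B).IsDendriform where
  prec_prec f g h := locInt_ext <| by
    filter_upwards [funDend_prec_coe ((funDend k B).prec f g) h, funDend_prec_coe f g,
      funDend_prec_coe f ((funDend k B).prec g h + (funDend k B).succ g h),
      ae_restrict_mem measurableSet_Ioi] with s h₁ h₂ h₃ hs
    rw [h₁, h₂, h₃, ← prim_mul_prim g h (le_of_lt hs), mul_assoc]
  succ_prec f g h := locInt_ext <| by
    filter_upwards [funDend_prec_coe ((funDend k B).succ f g) h, funDend_succ_coe f g,
      funDend_succ_coe f ((funDend k B).prec g h), funDend_prec_coe g h] with s h₁ h₂ h₃ h₄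
    rw [h₁, h₂, h₃, h₄, mul_assoc]
  succ_succ f g h := locInt_ext <| by
    filter_upwards [funDend_succ_coe f ((funDend k B).succ g h), funDend_succ_coe g h,
      funDend_succ_coe ((funDend k B).prec f g + (funDend k B).succ f g) h,
      ae_restrict_mem measurableSet_Ioi] with s h₁ h₂ h₃ hs
    rw [h₁, h₂, h₃, ← prim_mul_prim f g (le_of_lt hs), mul_assoc]

/-! ### Iterated integrals -/

/-- The bound may vary with the point, as is needed for simplices bounded by a coordinate of another
one. -/
theorem measurableSet_mem_simplex {X : Type*} [MeasurableSpace X] {n : ℕ} {f : X → Fin n → ℝ}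
    {h : X → ℝ} (hf : Measurable f) (hh : Measurable h) :
    MeasurableSet {x | f x ∈ simplex n (h x)} := by
  have hf' : ∀ i, Measurable fun x => f x i := fun i => (measurable_pi_apply i).comp hf
  have : {x | f x ∈ simplex n (h x)} = (⋂ i, ⋂ j, ⋂ _ : i < j, {x | f x i < f x j}) ∩
      ⋂ i, ({x | 0 < f x i} ∩ {x | f x i < h x}) := by
    ext x
    simp only [Set.mem_inter_iff, Set.mem_iInter]
    exact Iff.rfl
  rw [this]
  exact (MeasurableSet.iInter fun i => .iInter fun j => .iInter fun _ =>
    measurableSet_lt (hf' i) (hf' j)).inter (.iInter fun i =>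
      (measurableSet_lt measurable_const (hf' i)).inter (measurableSet_lt (hf' i) hh))

theorem measurableSet_simplex (n : ℕ) (s : ℝ) : MeasurableSet (simplex n s) :=
  measurableSet_mem_simplex measurable_id measurable_const

theorem stronglyMeasurable_permProd (a : LocInt k B) {n : ℕ} (σ : Equiv.Perm (Fin n)) :
    StronglyMeasurable (permProd a σ) := by
  have := List.stronglyMeasurable_fun_prod (List.ofFn fun i (u : Fin n → ℝ) => a.1 (u (σ i)))
    (fun f hf => by
      obtain ⟨i, rfl⟩ := List.mem_ofFn.1 hf
      exact a.1.stronglyMeasurable.comp_measurable (measurable_pi_apply _))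
  simp only [List.map_ofFn, Function.comp_def] at this
  exact this

theorem norm_permProd_le (a : LocInt k B) {n : ℕ} (hn : 0 < n) (σ : Equiv.Perm (Fin n))
    (u : Fin n → ℝ) : ‖permProd a σ u‖ ≤ ∏ i, ‖a.1 (u i)‖ := by
  -- The norm of the empty product `1` is not assumed to be at most `1`, hence `0 < n`.
  refine (List.norm_prod_le' fun h => hn.ne' (by simpa using congrArg List.length h)).trans ?_
  rw [List.map_ofFn, List.prod_ofFn]
  exact (Equiv.prod_comp σ fun i => ‖a.1 (u i)‖).le

/-- On the cube `(0, s)ⁿ` the integrand is dominated by the product of the integrable functions `‖a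
(u i)‖`. -/
theorem integrableOn_permProd (a : LocInt k B) {n : ℕ} (hn : 0 < n) (σ : Equiv.Perm (Fin n))
    (s : ℝ) : IntegrableOn (permProd a σ) (simplex n s) := by
  have h : IntegrableOn (permProd a σ) (Set.univ.pi fun _ => Set.Ioo 0 s) := by
    rw [IntegrableOn, volume_pi, Measure.restrict_pi_pi]
    exact (Integrable.fintype_prod (f := fun _ x => ‖a.1 x‖)
      fun _ => (integrableOn_locInt a s).norm).mono'
        (stronglyMeasurable_permProd a σ).aestronglyMeasurable
        (.of_forall fun u => norm_permProd_le a hn σ u)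
  exact h.mono_set fun u hu i _ => hu.2 i

theorem snoc_mem_simplex {n : ℕ} {v : Fin n → ℝ} {t s : ℝ} :
    (Fin.snoc v t : Fin (n + 1) → ℝ) ∈ simplex (n + 1) s ↔ t ∈ Set.Ioo 0 s ∧ v ∈ simplex n t := by
  constructor
  · rintro ⟨hm, hb⟩
    refine ⟨by simpa using hb (Fin.last n), fun i j hij => ?_, fun i => ⟨?_, ?_⟩⟩
    · simpa using hm (Fin.castSucc_lt_castSucc_iff.2 hij)
    · simpa using (hb i.castSucc).1
    · simpa using hm (Fin.castSucc_lt_last i)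
  · rintro ⟨ht, hm, hb⟩
    refine ⟨fun i j => ?_, fun i => ?_⟩
    · refine i.lastCases (fun h => absurd (Fin.le_last j) (not_le.2 h)) fun i => ?_
      refine j.lastCases (fun _ => by simpa using (hb i).2) fun j h => ?_
      simpa using hm (Fin.castSucc_lt_castSucc_iff.1 h)
    · refine i.lastCases (by simpa using ht) fun i => ?_
      simpa using ⟨(hb i).1, (hb i).2.trans ht.2⟩

/-- Fubini's theorem for the simplex `0 < u_1 < ⋯ < u_{n+1} < s`, with the outer integral over the
largest variable. -/
theorem integral_simplex_succ {n : ℕ} {s : ℝ} {φ : (Fin (n + 1) → ℝ) → B}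
    (hφ : IntegrableOn φ (simplex (n + 1) s)) :
    IntegrableOn (fun t => ∫ v in simplex n t, φ (Fin.snoc v t)) (Set.Ioo 0 s) ∧
    (∀ᵐ t ∂volume.restrict (Set.Ioo 0 s),
      IntegrableOn (fun v => φ (Fin.snoc v t)) (simplex n t)) ∧
    ∫ u in simplex (n + 1) s, φ u =
      ∫ t in Set.Ioo 0 s, ∫ v in simplex n t, φ (Fin.snoc v t) := by
  have hmp := (volume_preserving_piFinSuccAbove (fun _ : Fin (n + 1) => ℝ) (Fin.last n)).symm
  set e := (MeasurableEquiv.piFinSuccAbove (fun _ : Fin (n + 1) => ℝ) (Fin.last n)).symm with he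
  have hsnoc : ∀ p, e p = Fin.snoc p.2 p.1 := fun p => by
    rw [he, MeasurableEquiv.piFinSuccAbove_symm_apply]
    simp [Fin.snocEquiv]
  have hΦ : Integrable ((simplex (n + 1) s).indicator φ) :=
    (integrable_indicator_iff (measurableSet_simplex _ _)).2 hφ
  have hΦ' := (hmp.integrable_comp_emb e.measurableEmbedding).2 hΦ
  have hind : ∀ t v, ((simplex (n + 1) s).indicator φ ∘ e) (t, v) =
      (Set.Ioo 0 s).indicator
        (fun t => (simplex n t).indicator (fun v => φ (Fin.snoc v t)) v) t := fun t v => by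
    rw [Function.comp_apply, hsnoc]
    by_cases ht : t ∈ Set.Ioo 0 s
    · rw [Set.indicator_of_mem ht]
      by_cases hv : v ∈ simplex n t
      · rw [Set.indicator_of_mem hv, Set.indicator_of_mem (snoc_mem_simplex.2 ⟨ht, hv⟩)]
      · rw [Set.indicator_of_notMem hv,
          Set.indicator_of_notMem fun h => hv (snoc_mem_simplex.1 h).2]
    · rw [Set.indicator_of_notMem ht, Set.indicator_of_notMem fun h => ht (snoc_mem_simplex.1 h).1]
  have hint : ∀ t, ∫ v, ((simplex (n + 1) s).indicator φ ∘ e) (t, v) =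
      (Set.Ioo 0 s).indicator (fun t => ∫ v in simplex n t, φ (Fin.snoc v t)) t := fun t => by
    simp only [hind]
    by_cases ht : t ∈ Set.Ioo 0 s
    · simp only [Set.indicator_of_mem ht, integral_indicator (measurableSet_simplex n t)]
    · simp [Set.indicator_of_notMem ht]
  refine ⟨?_, ?_, ?_⟩
  · have := hΦ'.integral_prod_left
    simp only [hint] at this
    exact (integrable_indicator_iff measurableSet_Ioo).1 this
  · rw [ae_restrict_iff' measurableSet_Ioo]
    filter_upwards [hΦ'.prod_right_ae] with t ht hts
    simp only [hind, Set.indicator_of_mem hts] at ht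
    exact (integrable_indicator_iff (measurableSet_simplex n t)).1 ht
  · rw [← integral_indicator (measurableSet_simplex _ _), ← integral_indicator measurableSet_Ioo,
      ← hmp.integral_comp e.measurableEmbedding]
    refine (integral_prod _ hΦ').trans ?_
    exact integral_congr_ae (.of_forall hint)

/-! ### The derivatives of the iterated integrals -/

theorem locallyIntegrable_slice (a : LocInt k B) {n : ℕ} (σ : Equiv.Perm (Fin (n + 1))) :
    LocallyIntegrable (fun t => ∫ v in simplex n t, permProd a σ (Fin.snoc v t)) halfLine :=
  locallyIntegrable_halfLine fun s =>
    (integral_simplex_succ (integrableOn_permProd a n.succ_pos σ s)).1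

/-- The derivative of the iterated integral attached to `σ`, as a locally integrable function: the
largest variable is the argument of this function and the other variables are integrated. -/
noncomputable def sliceInt (a : LocInt k B) {n : ℕ} (σ : Equiv.Perm (Fin (n + 1))) : LocInt k B :=
  ⟨AEEqFun.mk _ (locallyIntegrable_slice a σ).aestronglyMeasurable,
    locallyIntegrable_congr (locallyIntegrable_slice a σ) (AEEqFun.coeFn_mk _ _).symm⟩

theorem sliceInt_coe (a : LocInt k B) {n : ℕ} (σ : Equiv.Perm (Fin (n + 1))) :
    (sliceInt a σ).1 =ᵐ[halfLine] fun t => ∫ v in simplex n t, permProd a σ (Fin.snoc v t) :=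
  AEEqFun.coeFn_mk _ _

/-- The derivative of the iterated integral attached to a basis vector. -/
noncomputable def permDeriv (a : LocInt k B) : PermIdx → LocInt k B
  | ⟨⟨0, _⟩, _⟩ => 0
  | ⟨⟨_ + 1, σ⟩, _⟩ => sliceInt a σ

theorem prim_sliceInt (a : LocInt k B) {n : ℕ} (σ : Equiv.Perm (Fin (n + 1))) {s : ℝ}
    (hs : 0 ≤ s) : prim (sliceInt a σ) s = iterInt a σ s := by
  rw [prim_eq _ hs, iterInt,
    (integral_simplex_succ (integrableOn_permProd a n.succ_pos σ s)).2.2]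
  exact integral_congr_ae (ae_Ioo_of_ae_halfLine (sliceInt_coe a σ) s)

theorem prim_permDeriv (a : LocInt k B) (p : PermIdx) {s : ℝ} (hs : 0 ≤ s) :
    prim (permDeriv a p) s = iterInt a p.1.2 s := by
  obtain ⟨⟨n, σ⟩, hn⟩ := p
  cases n with
  | zero => exact absurd hn (lt_irrefl 0)
  | succ n => exact prim_sliceInt a σ hs

/-- The linear map which sends a permutation to the derivative of its iterated integral. -/
noncomputable def permToFun (a : LocInt k B) : PermSpace k →ₗ[k] LocInt k B :=
  Finsupp.linearCombination k (permDeriv a)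

theorem permToFun_single (a : LocInt k B) (p : PermIdx) :
    permToFun a (Finsupp.single p 1) = permDeriv a p := by
  simp [permToFun]

theorem permToFun_isFTilde [CompleteSpace B] (a : LocInt k B) : IsFTilde a (permToFun a) := by
  intro n hn σ
  rw [permToFun_single]
  exact ae_hasDerivAt_of_prim_eq fun s hs => prim_permDeriv a (permIdx hn σ) hs.le

theorem IsFTilde.unique {a : LocInt k B} {F F' : PermSpace k →ₗ[k] LocInt k B}
    (h : IsFTilde a F) (h' : IsFTilde a F') : F = F' := by
  refine Finsupp.lhom_ext' fun ⟨⟨n, σ⟩, hn⟩ => LinearMap.ext_ring ?_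
  exact locInt_ext_hasDerivAt (h n hn σ) (h' n hn σ)

/-! ### Products of iterated integrals -/

/-- `(u, w) ↦ u ++ w` as a measurable equivalence. -/
def appendEquiv (n m : ℕ) : (Fin n → ℝ) × (Fin m → ℝ) ≃ᵐ (Fin (n + m) → ℝ) :=
  (MeasurableEquiv.sumPiEquivProdPi fun _ : Fin n ⊕ Fin m => ℝ).symm.trans
    (MeasurableEquiv.arrowCongr' finSumFinEquiv (.refl ℝ))

theorem appendEquiv_apply {n m : ℕ} (p : (Fin n → ℝ) × (Fin m → ℝ)) :
    appendEquiv n m p = Fin.append p.1 p.2 := by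
  funext i
  refine i.addCases (fun i => ?_) fun i => ?_
  · rw [Fin.append_left]
    simp [appendEquiv, MeasurableEquiv.arrowCongr', Equiv.arrowCongr', Equiv.arrowCongr,
      MeasurableEquiv.coe_sumPiEquivProdPi_symm]
  · rw [Fin.append_right]
    simp [appendEquiv, MeasurableEquiv.arrowCongr', Equiv.arrowCongr', Equiv.arrowCongr,
      MeasurableEquiv.coe_sumPiEquivProdPi_symm]

theorem measurePreserving_appendEquiv (n m : ℕ) : MeasurePreserving (appendEquiv n m) :=
  (volume_measurePreserving_sumPiEquivProdPi_symm _).trans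
    (volume_preserving_arrowCongr' _ _ (MeasurePreserving.id _))

/-- `(u, w) ↦ (u ++ w) ∘ ω⁻¹` as a measurable equivalence. -/
def shuffleEquiv {n m : ℕ} (ω : Equiv.Perm (Fin (n + m))) :
    (Fin n → ℝ) × (Fin m → ℝ) ≃ᵐ (Fin (n + m) → ℝ) :=
  (appendEquiv n m).trans (MeasurableEquiv.arrowCongr' ω (.refl ℝ))

theorem shuffleEquiv_apply {n m : ℕ} (ω : Equiv.Perm (Fin (n + m)))
    (p : (Fin n → ℝ) × (Fin m → ℝ)) (i : Fin (n + m)) :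
    shuffleEquiv ω p (ω i) = Fin.append p.1 p.2 i := by
  rw [← appendEquiv_apply]
  simp [shuffleEquiv, MeasurableEquiv.arrowCongr', Equiv.arrowCongr', Equiv.arrowCongr]

theorem measurePreserving_shuffleEquiv {n m : ℕ} (ω : Equiv.Perm (Fin (n + m))) :
    MeasurePreserving (shuffleEquiv ω) :=
  (measurePreserving_appendEquiv n m).trans
    (volume_preserving_arrowCongr' _ _ (MeasurePreserving.id _))

/-- Coordinate `ω i` of the shuffled point is coordinate `i` of `u ++ w`, so `ω` cancels and the
product splits at place `n` with its order kept. -/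
theorem permProd_shuffleEquiv (a : LocInt k B) {n m : ℕ} (σ : Equiv.Perm (Fin n))
    (τ : Equiv.Perm (Fin m)) (ω : Equiv.Perm (Fin (n + m))) (p : (Fin n → ℝ) × (Fin m → ℝ)) :
    permProd a (ω * concat σ τ) (shuffleEquiv ω p) = permProd a σ p.1 * permProd a τ p.2 := by
  rw [permProd, permProd, permProd, ← List.prod_append, ← List.ofFn_fin_append]
  congr 2
  funext i
  rw [Equiv.Perm.mul_apply, shuffleEquiv_apply]
  refine i.addCases (fun i => ?_) fun i => ?_ <;> simp

theorem shuffleEquiv_mem_simplex {n m : ℕ} {s : ℝ} {ω : Equiv.Perm (Fin (n + m))}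
    {p : (Fin n → ℝ) × (Fin m → ℝ)} : shuffleEquiv ω p ∈ simplex (n + m) s ↔
      (∀ i j, ω i < ω j ↔ Fin.append p.1 p.2 i < Fin.append p.1 p.2 j) ∧
        ∀ i, Fin.append p.1 p.2 i ∈ Set.Ioo 0 s := by
  refine and_congr (strictMono_iff_lt_iff ω fun i => shuffleEquiv_apply ω p i) ?_
  rw [← ω.forall_congr_right]
  simp only [shuffleEquiv_apply, Set.mem_Ioo]

/-- Two coordinates agree only on finitely many hyperplanes, which are null. -/
theorem ae_injective (n : ℕ) : ∀ᵐ x : Fin n → ℝ, Function.Injective x := by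
  have h : ∀ i j : Fin n, i ≠ j → ∀ᵐ x : Fin n → ℝ, x i ≠ x j := fun i j hij => by
    let L : (Fin n → ℝ) →ₗ[ℝ] ℝ := LinearMap.proj (R := ℝ) (φ := fun _ => ℝ) i - LinearMap.proj j
    have hL : LinearMap.ker L ≠ ⊤ := fun h => by
      have : L (Pi.single i 1) = 0 := by
        rw [← LinearMap.mem_ker, h]; trivial
      simp [L, hij.symm] at this
    have := Measure.addHaar_submodule (volume : Measure (Fin n → ℝ)) _ hL
    rw [ae_iff]
    convert this using 2
    ext x
    simp [L, sub_eq_zero]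
  simp only [← ae_all_iff] at h
  filter_upwards [h] with x hx i j hij
  by_contra hne
  exact hx i j hne hij

open Classical in
/-- A decomposition of a domain into images of simplices under shuffles gives a decomposition of
the integral of a product. -/
theorem integral_eq_sum_iterInt (a : LocInt k B) {n m : ℕ} (hn : 0 < n + m)
    (σ : Equiv.Perm (Fin n)) (τ : Equiv.Perm (Fin m)) (s : ℝ)
    (d : Equiv.Perm (Fin (n + m)) → Prop) (D : Set ((Fin n → ℝ) × (Fin m → ℝ)))
    (hD : ∀ (p : (Fin n → ℝ) × (Fin m → ℝ)) (ρ : Equiv.Perm (Fin (n + m))),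
      (∀ i j, ρ i < ρ j ↔ Fin.append p.1 p.2 i < Fin.append p.1 p.2 j) →
        (p ∈ D ↔ d ρ ∧ ∀ i, Fin.append p.1 p.2 i ∈ Set.Ioo 0 s)) :
    ∫ p in D, permProd a σ p.1 * permProd a τ p.2 =
      ∑ ω : Equiv.Perm (Fin (n + m)) with d ω, iterInt a (ω * concat σ τ) s := by
  have hmeas : ∀ ω : Equiv.Perm (Fin (n + m)),
      MeasurableSet (shuffleEquiv ω ⁻¹' simplex (n + m) s) := fun ω =>
    (shuffleEquiv ω).measurable (measurableSet_simplex _ _)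
  have hint : ∀ ω : Equiv.Perm (Fin (n + m)), ∫ p in shuffleEquiv ω ⁻¹' simplex (n + m) s,
      permProd a σ p.1 * permProd a τ p.2 = iterInt a (ω * concat σ τ) s := fun ω => by
    rw [iterInt, ← (measurePreserving_shuffleEquiv ω).setIntegral_preimage_emb
      (shuffleEquiv ω).measurableEmbedding]
    simp only [permProd_shuffleEquiv]
  have hintble : ∀ ω : Equiv.Perm (Fin (n + m)), IntegrableOn
      (fun p : (Fin n → ℝ) × (Fin m → ℝ) => permProd a σ p.1 * permProd a τ p.2)
      (shuffleEquiv ω ⁻¹' simplex (n + m) s) := fun ω => by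
    have := ((measurePreserving_shuffleEquiv ω).integrableOn_comp_preimage
      (shuffleEquiv ω).measurableEmbedding).2 (integrableOn_permProd a hn (ω * concat σ τ) s)
    simpa only [Function.comp_def, permProd_shuffleEquiv] using this
  have hdisj : ∀ ω ω' : Equiv.Perm (Fin (n + m)), ω ≠ ω' →
      Disjoint (shuffleEquiv ω ⁻¹' simplex (n + m) s) (shuffleEquiv ω' ⁻¹' simplex (n + m) s) :=
    fun ω ω' h => Set.disjoint_left.2 fun p h₁ h₂ => h <| perm_eq_of_lt_iff fun i j =>
      ((shuffleEquiv_mem_simplex.1 h₁).1 i j).trans ((shuffleEquiv_mem_simplex.1 h₂).1 i j).symm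
  simp only [← hint]
  rw [← integral_biUnion_finset _ (fun ω _ => hmeas ω) (fun ω _ ω' _ h => hdisj ω ω' h)
    fun ω _ => hintble ω]
  refine setIntegral_congr_set ?_
  -- Off this null set `p` has a unique relative order `ρ`, and `ρ` is the only index whose piece
  -- can contain `p`.
  have hinj := (measurePreserving_appendEquiv n m).quasiMeasurePreserving.ae (ae_injective (n + m))
  filter_upwards [hinj] with p hp
  rw [appendEquiv_apply] at hp
  obtain ⟨ρ, hρ⟩ := exists_perm_lt_iff _ hp
  have key : p ∈ D ↔ p ∈ ⋃ ω ∈ Finset.univ.filter d, shuffleEquiv ω ⁻¹' simplex (n + m) s := by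
    rw [hD p ρ hρ]
    simp only [Set.mem_iUnion, Finset.mem_filter, Finset.mem_univ, true_and, exists_prop,
      Set.mem_preimage, shuffleEquiv_mem_simplex]
    refine ⟨fun h => ⟨ρ, h.1, hρ, h.2⟩, fun ⟨ω, h₁, h₂, h₃⟩ => ⟨?_, h₃⟩⟩
    rwa [perm_eq_of_lt_iff fun i j => (hρ i j).trans (h₂ i j).symm]
  exact propext key

/-! ### Shuffles of iterated integrals -/

theorem concat_one_one (n m : ℕ) :
    concat (1 : Equiv.Perm (Fin n)) (1 : Equiv.Perm (Fin m)) = 1 := by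
  refine Equiv.ext fun i => ?_
  refine i.addCases (fun i => ?_) fun i => ?_ <;> simp

theorem isStd_one_iff {α : Type*} [LinearOrder α] {n : ℕ} {x : Fin n → α} :
    IsStd 1 x ↔ StrictMono x :=
  ⟨fun h i j hij => (h i j hij).1 hij, fun h _ _ hij => ⟨fun _ => h hij, fun _ => hij⟩⟩

theorem forall_append_iff {α : Type*} {n m : ℕ} {u : Fin n → α} {w : Fin m → α} {P : α → Prop} :
    (∀ i, P (Fin.append u w i)) ↔ (∀ i, P (u i)) ∧ ∀ j, P (w j) := by
  refine ⟨fun h => ⟨fun i => ?_, fun j => ?_⟩, fun h i => ?_⟩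
  · simpa using h (Fin.castAdd m i)
  · simpa using h (Fin.natAdd n j)
  · refine i.addCases (fun i => ?_) fun j => ?_
    · simpa using h.1 i
    · simpa using h.2 j

theorem isShuffle_iff_strictMono {n m : ℕ} {u : Fin n → ℝ} {w : Fin m → ℝ}
    {ρ : Equiv.Perm (Fin (n + m))}
    (hρ : ∀ i j, ρ i < ρ j ↔ Fin.append u w i < Fin.append u w j) :
    IsShuffle n m ρ ↔ StrictMono u ∧ StrictMono w := by
  rw [isShuffle_iff_isStd (σ := 1) (τ := 1) (by rw [concat_one_one, mul_one])
    (fun i j _ => hρ i j), isStd_one_iff, isStd_one_iff]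

/-- Once `u` and `w` increase, the largest coordinate lies in `u` exactly when the last one of `u`
bounds all of `w`. -/
theorem isShuffle₂_iff_mem_simplex {n m : ℕ} {s : ℝ} {u : Fin (n + 1) → ℝ} {w : Fin m → ℝ}
    {ρ : Equiv.Perm (Fin (n + 1 + m))}
    (hρ : ∀ i j, ρ i < ρ j ↔ Fin.append u w i < Fin.append u w j) :
    IsShuffle₂ (n + 1) m ρ ∧ (∀ i, Fin.append u w i ∈ Set.Ioo 0 s) ↔
      u ∈ simplex (n + 1) s ∧ w ∈ simplex m (u (Fin.last n)) := by
  rw [isShuffle₂_iff n.succ_pos (σ := 1) (τ := 1) (ρ := ρ) (by rw [concat_one_one, mul_one]),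
    isShuffle_iff_strictMono hρ, forall_append_iff]
  simp only [hρ, Fin.append_left, Fin.append_right]
  constructor
  · rintro ⟨⟨⟨hu, hw⟩, i, hi⟩, hus, hws⟩
    exact ⟨⟨hu, hus⟩, hw, fun j => ⟨(hws j).1, (hi j).trans_le (hu.monotone (Fin.le_last i))⟩⟩
  · rintro ⟨⟨hu, hus⟩, hw, hws⟩
    exact ⟨⟨⟨hu, hw⟩, Fin.last n, fun j => (hws j).2⟩, hus,
      fun j => ⟨(hws j).1, (hws j).2.trans (hus _).2⟩⟩

theorem isShuffle₁_iff_mem_simplex {n m : ℕ} {s : ℝ} {u : Fin n → ℝ} {w : Fin (m + 1) → ℝ}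
    {ρ : Equiv.Perm (Fin (n + (m + 1)))}
    (hρ : ∀ i j, ρ i < ρ j ↔ Fin.append u w i < Fin.append u w j) :
    IsShuffle₁ n (m + 1) ρ ∧ (∀ i, Fin.append u w i ∈ Set.Ioo 0 s) ↔
      w ∈ simplex (m + 1) s ∧ u ∈ simplex n (w (Fin.last m)) := by
  rw [isShuffle₁_iff m.succ_pos (σ := 1) (τ := 1) (ρ := ρ) (by rw [concat_one_one, mul_one]),
    isShuffle_iff_strictMono hρ, forall_append_iff]
  simp only [hρ, Fin.append_left, Fin.append_right]
  constructor
  · rintro ⟨⟨⟨hu, hw⟩, i, hi⟩, hus, hws⟩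
    exact ⟨⟨hw, hws⟩, hu, fun j => ⟨(hus j).1, (hi j).trans_le (hw.monotone (Fin.le_last i))⟩⟩
  · rintro ⟨⟨hw, hws⟩, hu, hus⟩
    exact ⟨⟨⟨hu, hw⟩, Fin.last m, fun j => (hus j).2⟩,
      fun j => ⟨(hus j).1, (hus j).2.trans (hws _).2⟩, hws⟩

theorem simplex_subset {n : ℕ} {s t : ℝ} (h : s ≤ t) : simplex n s ⊆ simplex n t :=
  fun _ hu => ⟨hu.1, fun i => ⟨(hu.2 i).1, (hu.2 i).2.trans_le h⟩⟩

theorem integrableOn_permProd_mul (a : LocInt k B) {n m : ℕ} (hn : 0 < n) (hm : 0 < m)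
    (σ : Equiv.Perm (Fin n)) (τ : Equiv.Perm (Fin m)) (s : ℝ) :
    IntegrableOn (fun p : (Fin n → ℝ) × (Fin m → ℝ) => permProd a σ p.1 * permProd a τ p.2)
      (simplex n s ×ˢ simplex m s) := by
  rw [IntegrableOn, Measure.volume_eq_prod, ← Measure.prod_restrict]
  exact Integrable.mul_prod (integrableOn_permProd a hn σ s) (integrableOn_permProd a hm τ s)

/-- Fubini twice: integrating over `w` gives `iterInt a τ` at the last coordinate `t` of `u`, then
integrating over the other coordinates of `u` gives the slice at `t`. -/
theorem integral_sliceInt_mul [CompleteSpace B] (a : LocInt k B) {n m : ℕ} (hm : 0 < m)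
    (σ : Equiv.Perm (Fin (n + 1))) (τ : Equiv.Perm (Fin m)) (s : ℝ) :
    ∫ t in Set.Ioo 0 s, (sliceInt a σ).1 t * iterInt a τ t =
      ∫ p in {p : (Fin (n + 1) → ℝ) × (Fin m → ℝ) |
        p.1 ∈ simplex (n + 1) s ∧ p.2 ∈ simplex m (p.1 (Fin.last n))},
        permProd a σ p.1 * permProd a τ p.2 := by
  set D := {p : (Fin (n + 1) → ℝ) × (Fin m → ℝ) |
        p.1 ∈ simplex (n + 1) s ∧ p.2 ∈ simplex m (p.1 (Fin.last n))} with hD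
  have hDm : MeasurableSet D := (measurableSet_mem_simplex measurable_fst measurable_const).inter
    (measurableSet_mem_simplex measurable_snd ((measurable_pi_apply _).comp measurable_fst))
  have hint := (integrable_indicator_iff hDm).2
    ((integrableOn_permProd_mul a n.succ_pos hm σ τ s).mono_set fun p hp =>
      ⟨hp.1, simplex_subset (hp.1.2 _).2.le hp.2⟩)
  have hinner : ∀ u, ∫ w, D.indicator (fun p => permProd a σ p.1 * permProd a τ p.2) (u, w) =
      (simplex (n + 1) s).indicator (fun u => permProd a σ u * iterInt a τ (u (Fin.last n))) u :=
    fun u => by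
      by_cases hu : u ∈ simplex (n + 1) s
      · have : ∀ w, D.indicator (fun p => permProd a σ p.1 * permProd a τ p.2) (u, w) =
            (simplex m (u (Fin.last n))).indicator (fun w => permProd a σ u * permProd a τ w) w :=
          fun w => by
            by_cases hw : w ∈ simplex m (u (Fin.last n))
            · rw [Set.indicator_of_mem hw, Set.indicator_of_mem (show (u, w) ∈ D from ⟨hu, hw⟩)]
            · rw [Set.indicator_of_notMem hw, Set.indicator_of_notMem fun h => hw h.2]
        simp only [this]
        rw [Set.indicator_of_mem hu, integral_indicator (measurableSet_simplex _ _),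
          integral_const_mul_of_integrable (integrableOn_permProd a hm τ _), iterInt]
      · have : ∀ w, D.indicator (fun p => permProd a σ p.1 * permProd a τ p.2) (u, w) = 0 :=
          fun w => Set.indicator_of_notMem (fun h => hu h.1) _
        simp [this, hu]
  -- Integrability of the partial integral, required for the second use of Fubini.
  have houter := hint.integral_prod_left
  simp only [hinner] at houter
  rw [integrable_indicator_iff (measurableSet_simplex _ _)] at houter
  rw [← integral_indicator hDm, Measure.volume_eq_prod, integral_prod _ hint]
  simp only [hinner]
  rw [integral_indicator (measurableSet_simplex _ _), (integral_simplex_succ houter).2.2]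
  refine integral_congr_ae ?_
  filter_upwards [ae_Ioo_of_ae_halfLine (sliceInt_coe a σ) s,
    (integral_simplex_succ (integrableOn_permProd a n.succ_pos σ s)).2.1] with t h₁ h₂
  simp only [Fin.snoc_last]
  rw [h₁, integral_mul_const_of_integrable h₂]

theorem integral_mul_sliceInt [CompleteSpace B] (a : LocInt k B) {n m : ℕ} (hn : 0 < n)
    (σ : Equiv.Perm (Fin n)) (τ : Equiv.Perm (Fin (m + 1))) (s : ℝ) :
    ∫ t in Set.Ioo 0 s, iterInt a σ t * (sliceInt a τ).1 t =
      ∫ p in {p : (Fin n → ℝ) × (Fin (m + 1) → ℝ) |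
        p.2 ∈ simplex (m + 1) s ∧ p.1 ∈ simplex n (p.2 (Fin.last m))},
        permProd a σ p.1 * permProd a τ p.2 := by
  set D := {p : (Fin n → ℝ) × (Fin (m + 1) → ℝ) |
        p.2 ∈ simplex (m + 1) s ∧ p.1 ∈ simplex n (p.2 (Fin.last m))} with hD
  have hDm : MeasurableSet D := (measurableSet_mem_simplex measurable_snd measurable_const).inter
    (measurableSet_mem_simplex measurable_fst ((measurable_pi_apply _).comp measurable_snd))
  have hint := (integrable_indicator_iff hDm).2
    ((integrableOn_permProd_mul a hn m.succ_pos σ τ s).mono_set fun p hp =>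
      ⟨simplex_subset (hp.1.2 _).2.le hp.2, hp.1⟩)
  have hinner : ∀ w, ∫ u, D.indicator (fun p => permProd a σ p.1 * permProd a τ p.2) (u, w) =
      (simplex (m + 1) s).indicator (fun w => iterInt a σ (w (Fin.last m)) * permProd a τ w) w :=
    fun w => by
      by_cases hw : w ∈ simplex (m + 1) s
      · have : ∀ u, D.indicator (fun p => permProd a σ p.1 * permProd a τ p.2) (u, w) =
            (simplex n (w (Fin.last m))).indicator (fun u => permProd a σ u * permProd a τ w) u :=
          fun u => by
            by_cases hu : u ∈ simplex n (w (Fin.last m))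
            · rw [Set.indicator_of_mem hu, Set.indicator_of_mem (show (u, w) ∈ D from ⟨hw, hu⟩)]
            · rw [Set.indicator_of_notMem hu, Set.indicator_of_notMem fun h => hu h.2]
        simp only [this]
        rw [Set.indicator_of_mem hw, integral_indicator (measurableSet_simplex _ _),
          integral_mul_const_of_integrable (integrableOn_permProd a hn σ _), iterInt]
      · have : ∀ u, D.indicator (fun p => permProd a σ p.1 * permProd a τ p.2) (u, w) = 0 :=
          fun u => Set.indicator_of_notMem (fun h => hw h.1) _
        simp [this, hw]
  have houter := hint.integral_prod_right
  simp only [hinner] at houter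
  rw [integrable_indicator_iff (measurableSet_simplex _ _)] at houter
  rw [← integral_indicator hDm, Measure.volume_eq_prod, integral_prod_symm _ hint]
  simp only [hinner]
  rw [integral_indicator (measurableSet_simplex _ _), (integral_simplex_succ houter).2.2]
  refine integral_congr_ae ?_
  filter_upwards [ae_Ioo_of_ae_halfLine (sliceInt_coe a τ) s,
    (integral_simplex_succ (integrableOn_permProd a m.succ_pos τ s)).2.1] with t h₁ h₂
  simp only [Fin.snoc_last]
  rw [h₁, integral_const_mul_of_integrable h₂]

/-! ### The derivative map is a dendriform morphism, and its composite with `ψ*` -/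

theorem permToFun_isDendHom [CompleteSpace B] (a : LocInt k B) :
    IsDendHom (permDend k) (funDend k B) (permToFun a) := by
  classical
  refine isDendHom_of_basis (fun p q => locInt_ext_prim fun s hs => ?_)
    fun p q => locInt_ext_prim fun s hs => ?_
  · simp only [permDend, bilin_single, map_sum, permToFun_single]
    rw [prim_sum, prim_funDend_prec _ _ hs.le]
    simp only [prim_permDeriv _ _ hs.le]
    rw [setIntegral_congr_fun (g := fun t => (permDeriv a p).1 t * iterInt a q.1.2 t)
      measurableSet_Ioo fun t ht => by simp only [prim_permDeriv _ _ ht.1.le]]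
    obtain ⟨⟨n, σ⟩, hn⟩ := p
    obtain ⟨⟨m, τ⟩, hm⟩ := q
    obtain ⟨n, rfl⟩ := Nat.exists_eq_add_one_of_ne_zero (ne_of_gt hn)
    -- The right side is an integral over the pairs whose largest coordinate ends the first block;
    -- cutting this domain by relative order gives the sum over `IsShuffle₂`.
    refine Eq.symm ((integral_sliceInt_mul a hm σ τ s).trans
      (integral_eq_sum_iterInt a (Nat.add_pos_left hn m) σ τ s _ _ fun p ρ hρ => ?_))
    exact (isShuffle₂_iff_mem_simplex hρ).symm
  · simp only [permDend, bilin_single, map_sum, permToFun_single]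
    rw [prim_sum, prim_funDend_succ _ _ hs.le]
    simp only [prim_permDeriv _ _ hs.le]
    rw [setIntegral_congr_fun (g := fun t => iterInt a p.1.2 t * (permDeriv a q).1 t)
      measurableSet_Ioo fun t ht => by simp only [prim_permDeriv _ _ ht.1.le]]
    obtain ⟨⟨n, σ⟩, hn⟩ := p
    obtain ⟨⟨m, τ⟩, hm⟩ := q
    obtain ⟨m, rfl⟩ := Nat.exists_eq_add_one_of_ne_zero (ne_of_gt hm)
    refine Eq.symm ((integral_mul_sliceInt a hn σ τ s).trans
      (integral_eq_sum_iterInt a (Nat.add_pos_left hn _) σ τ s _ _ fun p ρ hρ => ?_))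
    exact (isShuffle₁_iff_mem_simplex hρ).symm

theorem permToFun_single_one [CompleteSpace B] (a : LocInt k B) :
    permToFun a (Finsupp.single (permIdx Nat.one_pos 1) 1) = a := by
  refine locInt_ext_prim fun s hs => ?_
  rw [permToFun_single, prim_permDeriv _ _ hs.le, prim_eq a hs.le]
  refine ((integral_simplex_succ (integrableOn_permProd a one_pos 1 s)).2.2).trans ?_
  refine setIntegral_congr_fun measurableSet_Ioo fun t _ => ?_
  -- The inner integral is over a one-point space, where the volume is a Dirac mass.
  have h : simplex 0 t = Set.univ :=
    Set.eq_univ_of_forall fun u => ⟨fun i => i.elim0, fun i => i.elim0⟩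
  have h' : ∀ v : Fin 0 → ℝ, permProd a 1 (Fin.snoc v t : Fin 1 → ℝ) = a.1 t := fun v => by
    simp [permProd, Fin.snoc]
  simp only [h', h, Measure.volume_pi_eq_dirac (fun i : Fin 0 => i.elim0)]
  simp

/-- The composite itself gives the existence of `F_a`, so the freeness of the tree algebra is not
needed. -/
theorem permToFun_psiStar_isFa [CompleteSpace B] (a : LocInt k B) :
    IsFa a (permToFun a ∘ₗ psiStar k) where
  left :=
    { map_prec := fun x y => by
        simp only [LinearMap.comp_apply, psiStar_isDendHom.map_prec,
          (permToFun_isDendHom a).map_prec]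
      map_succ := fun x y => by
        simp only [LinearMap.comp_apply, psiStar_isDendHom.map_succ,
          (permToFun_isDendHom a).map_succ] }
  right := by rw [LinearMap.comp_apply, psiStar_treeY, permToFun_single_one]

theorem IsFa.unique {a : LocInt k B} {F F' : TreeSpace k →ₗ[k] LocInt k B} (h : IsFa a F)
    (h' : IsFa a F') : F = F' :=
  h.1.treeSpace_ext h'.1 (h.2.trans h'.2.symm)

end Functions

end MagnusPerm

/-! ### The main theorem -/

theorem theorem5p3 {k B : Type*} [RCLike k] [NormedRing B] [NormedAlgebra ℝ B]
    [NormedAlgebra k B] [CompleteSpace B] (a : MagnusPerm.LocInt k B) :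
    -- the three pairs of operations are dendriform algebras
    (MagnusPerm.permDend k).IsDendriform ∧
    (MagnusPerm.treeDend k).IsDendriform ∧
    (MagnusPerm.funDend k B).IsDendriform ∧
    -- the iterated integrals converge absolutely
    (∀ (n : ℕ) (_ : 0 < n) (σ : Equiv.Perm (Fin n)) (s : ℝ),
      MeasureTheory.IntegrableOn (MagnusPerm.permProd a σ) (MagnusPerm.simplex n s)) ∧
    -- the linear map `Ft` of their derivatives is well defined, and so is the dendriform
    -- morphism `F` with `F Y = a`
    (∃! Ft : MagnusPerm.PermSpace k →ₗ[k] MagnusPerm.LocInt k B, MagnusPerm.IsFTilde a Ft) ∧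
    (∃! F : MagnusPerm.TreeSpace k →ₗ[k] MagnusPerm.LocInt k B, MagnusPerm.IsFa a F) ∧
    -- `Ft` is a dendriform morphism, and `F = Ft ∘ ψ*`
    ∀ (Ft : MagnusPerm.PermSpace k →ₗ[k] MagnusPerm.LocInt k B)
      (F : MagnusPerm.TreeSpace k →ₗ[k] MagnusPerm.LocInt k B),
      MagnusPerm.IsFTilde a Ft → MagnusPerm.IsFa a F →
        MagnusPerm.IsDendHom (MagnusPerm.permDend k) (MagnusPerm.funDend k B) Ft ∧
          F = Ft ∘ₗ MagnusPerm.psiStar k := by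
  refine ⟨MagnusPerm.permDend_isDendriform, MagnusPerm.treeDend_isDendriform,
    MagnusPerm.funDend_isDendriform, fun n hn σ s => MagnusPerm.integrableOn_permProd a hn σ s,
    ⟨_, MagnusPerm.permToFun_isFTilde a, fun _ h => h.unique (MagnusPerm.permToFun_isFTilde a)⟩,
    ⟨_, MagnusPerm.permToFun_psiStar_isFa a,
      fun _ h => h.unique (MagnusPerm.permToFun_psiStar_isFa a)⟩,
    fun Ft F hFt hF => ?_⟩
  obtain rfl := hFt.unique (MagnusPerm.permToFun_isFTilde a)
  exact ⟨MagnusPerm.permToFun_isDendHom a, hF.unique (MagnusPerm.permToFun_psiStar_isFa a)⟩
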